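/- Let $C\in\mathbb{R}^{m\times n}$ have full row rank, let $\mathcal X\subseteq\mathbb{R}^n$ be measurable, and let $p:\mathcal X\to\mathbb{R}_{\ge 0}$ be an integrable weight with $\int_{\mathcal X}p(x)\,\mathrm{d}x>0$. Let $\mathcal W\subseteq\mathbb{R}^m$ be a measurable set with connected interior. Consider the response $y=Cx+w$ to the linear query $f(x)=Cx$, where the noise $w$ has a probability density $\gamma:\mathcal W\to\mathbb{R}_{\ge 0}$, extended by $0$ outside $\mathcal W$, that does not depend on $x$. Call $\gamma$ admissible if it is twice continuously differentiable over $\mathcal W$, continuous on the closure of $\mathcal W$, zero on $\partial\mathcal W$, satisfies $\int_{\mathcal W}\gamma=1$, and if for every $x\in\mathcal X$ the Fisher information matrix $$\mathcal I(x)=\int_{\{Cx\}\oplus\mathcal W}p(y|x)\left[\frac{\partial\log p(y|x)}{\partial x}\right]\left[\frac{\partial\log p(y|x)}{\partial x}\right]^{\top}\mathrm{d}y,\qquad p(y|x)=\gamma(y-Cx),$$ (the integrand being read as $0$ where $p(y|x)=0$) is finite and invertible. Let $\gamma^*$ maximise $\overline{\mathcal J}(\gamma)=\int_{\mathcal X}\mathrm{Tr}(\mathcal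 I(x)^{-1})\,p(x)\,\mathrm{d}x$ over all admissible $\gamma$, and put $u=\sqrt{\gamma^*}$. Then the Fisher information matrix of $\gamma^*$ is the same invertible matrix $\mathcal I$ for every $x\in\mathbb{R}^n$, $u$ is twice continuously differentiable in $\mathrm{int}\,\mathcal W$, and for some constant $\mu\in\mathbb{R}$ $$\begin{cases}\mathrm{Tr}\big(\mathcal I^{-2}C^\top D^2u(w)\,C\big)+\mu\,u(w)=0, & w\in\mathrm{int}\,\mathcal W,\\ u(w)=0, & w\in\partial\mathcal W,\\ u(w)\neq 0, & w\in\mathrm{int}\,\mathcal W,\\ \int_{\mathcal W}u(w)^2\,\mathrm{d}w=1.\end{cases}$$ -/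

import Mathlib

open MeasureTheory

noncomputable section

/-- The linear query `f(x) = C x`, between Euclidean spaces. -/
def linearQuery {m n : ℕ} (C : Matrix (Fin m) (Fin n) ℝ) (x : EuclideanSpace ℝ (Fin n)) :
    EuclideanSpace ℝ (Fin m) :=
  WithLp.toLp 2 (C.mulVec (fun i => x i))

/-- The density `p(y|x) = γ(y - f(x))` of the response `y = f(x) + w`, when the noise `w` has
density `γ`, independent of `x`. -/
def responseDensity {m n : ℕ} (f : EuclideanSpace ℝ (Fin n) → EuclideanSpace ℝ (Fin m))
    (γ : EuclideanSpace ℝ (Fin m) → ℝ) (y : EuclideanSpace ℝ (Fin m))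
    (x : EuclideanSpace ℝ (Fin n)) : ℝ :=
  γ (y - f x)

/-- The `i`-th component of `∂ log p(y|x) / ∂x`. -/
def score {m n : ℕ} (f : EuclideanSpace ℝ (Fin n) → EuclideanSpace ℝ (Fin m))
    (γ : EuclideanSpace ℝ (Fin m) → ℝ) (y : EuclideanSpace ℝ (Fin m))
    (x : EuclideanSpace ℝ (Fin n)) (i : Fin n) : ℝ :=
  fderiv ℝ (fun z => Real.log (responseDensity f γ y z)) x (EuclideanSpace.single i 1)

/-- The `(i, j)` entry of `p(y|x) [∂ log p(y|x) / ∂x] [∂ log p(y|x) / ∂x]ᵀ`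
(it vanishes wherever `p(y|x) = 0`). -/
def fisherIntegrand {m n : ℕ} (f : EuclideanSpace ℝ (Fin n) → EuclideanSpace ℝ (Fin m))
    (γ : EuclideanSpace ℝ (Fin m) → ℝ) (x : EuclideanSpace ℝ (Fin n)) (i j : Fin n)
    (y : EuclideanSpace ℝ (Fin m)) : ℝ :=
  responseDensity f γ y x * (score f γ y x i * score f γ y x j)

/-- The set `{f(x)} ⊕ W` of possible responses. -/
def responseSet {m n : ℕ} (f : EuclideanSpace ℝ (Fin n) → EuclideanSpace ℝ (Fin m))
    (W : Set (EuclideanSpace ℝ (Fin m))) (x : EuclideanSpace ℝ (Fin n)) :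
    Set (EuclideanSpace ℝ (Fin m)) :=
  (fun w => f x + w) '' W

/-- The Fisher information matrix `I(x)` of the response about `x`. -/
def fisherInformation {m n : ℕ} (f : EuclideanSpace ℝ (Fin n) → EuclideanSpace ℝ (Fin m))
    (W : Set (EuclideanSpace ℝ (Fin m))) (γ : EuclideanSpace ℝ (Fin m) → ℝ)
    (x : EuclideanSpace ℝ (Fin n)) : Matrix (Fin n) (Fin n) ℝ :=
  Matrix.of fun i j => ∫ y in responseSet f W x, fisherIntegrand f γ x i j y

/-- The Fisher information is finite and invertible at `x`, so that `Tr(I(x)⁻¹)` makes sense. -/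
structure HasRegularFisher {m n : ℕ} (f : EuclideanSpace ℝ (Fin n) → EuclideanSpace ℝ (Fin m))
    (W : Set (EuclideanSpace ℝ (Fin m))) (γ : EuclideanSpace ℝ (Fin m) → ℝ)
    (x : EuclideanSpace ℝ (Fin n)) : Prop where
  integrable : ∀ i j, IntegrableOn (fisherIntegrand f γ x i j) (responseSet f W x)
  invertible : IsUnit (fisherInformation f W γ x)

/-- `γ` is an admissible noise density on `W`, independent of `x`: a probability density
that is supported in `W`, twice continuously differentiable over `W`, and zero on `∂W`.
It is given on the whole space, with the value `0` off `W`; continuity on the closure gives the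
boundary condition its meaning also when `W` is not closed. -/
structure IsAdmissibleDensity {m : ℕ} (W : Set (EuclideanSpace ℝ (Fin m)))
    (γ : EuclideanSpace ℝ (Fin m) → ℝ) : Prop where
  nonneg : ∀ w, 0 ≤ γ w
  eq_zero_of_notMem : ∀ w, w ∉ W → γ w = 0
  integrable : IntegrableOn γ W
  integral_eq_one : ∫ w in W, γ w = 1
  contDiffOn : ContDiffOn ℝ 2 γ W
  continuousOn_closure : ContinuousOn γ (closure W)
  boundary : ∀ w ∈ frontier W, γ w = 0

/-- The densities among which the objective is maximised: the admissible ones whose Fisher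
information is finite and invertible at every database `x ∈ X`. -/
def feasibleDensities {m n : ℕ} (f : EuclideanSpace ℝ (Fin n) → EuclideanSpace ℝ (Fin m))
    (X : Set (EuclideanSpace ℝ (Fin n))) (W : Set (EuclideanSpace ℝ (Fin m))) :
    Set (EuclideanSpace ℝ (Fin m) → ℝ) :=
  {γ | IsAdmissibleDensity W γ ∧ ∀ x ∈ X, HasRegularFisher f W γ x}

/-- The objective `∫_X Tr(I(x)⁻¹) p(x) dx`, for the weight `p`. -/
def privacyObjective {m n : ℕ} (f : EuclideanSpace ℝ (Fin n) → EuclideanSpace ℝ (Fin m))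
    (X : Set (EuclideanSpace ℝ (Fin n))) (p : EuclideanSpace ℝ (Fin n) → ℝ)
    (W : Set (EuclideanSpace ℝ (Fin m))) (γ : EuclideanSpace ℝ (Fin m) → ℝ) : ℝ :=
  ∫ x in X, ((fisherInformation f W γ x)⁻¹).trace * p x

/-- `γ` maximises the objective among all feasible densities. -/
def IsOptimalDensity {m n : ℕ} (f : EuclideanSpace ℝ (Fin n) → EuclideanSpace ℝ (Fin m))
    (X : Set (EuclideanSpace ℝ (Fin n))) (p : EuclideanSpace ℝ (Fin n) → ℝ)
    (W : Set (EuclideanSpace ℝ (Fin m))) (γ : EuclideanSpace ℝ (Fin m) → ℝ) : Prop :=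
  γ ∈ feasibleDensities f X W ∧ IsMaxOn (privacyObjective f X p W) (feasibleDensities f X W) γ

/-- The Hessian matrix `D²u(w)`. -/
def hessianMatrix {m : ℕ} (u : EuclideanSpace ℝ (Fin m) → ℝ) (w : EuclideanSpace ℝ (Fin m)) :
    Matrix (Fin m) (Fin m) ℝ :=
  Matrix.of fun i j =>
    iteratedFDeriv ℝ 2 u w ![EuclideanSpace.single i 1, EuclideanSpace.single j 1]

end

/-! Translation invariance makes the Fisher matrix of an admissible density independent of `x`, so
the objective is `Tr(I⁻¹)` times a positive constant. Since `J ↦ Tr(J⁻¹)` is convex on positive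
matrices, its tangent inequality at the optimal `I` turns maximality into a linear statement: `γ`
minimises `Tr(I⁻¹ J I⁻¹)` over the Fisher matrices `J` of feasible densities
(`trace_inv_le_of_feasible`). For a density `s² / ∫ s²` this functional is at most `4 ∑ ∫ (∂_{v_a}
s)² / ∫ s²`, where the `v_a` are the columns of `C I⁻¹`. Hence `u = √γ` should be a ground state of
`L = ∑ ∂²_{v_a}`, with `L u + (Tr(I⁻¹) / 4) u = 0`.

Two obstacles remain, both at the zeros of `γ`, where `u` need not be differentiable. First, the
variation is performed on `√(γ + ε²) - ε`, which is `C²` on `W` and has no more energy than `γ`;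
letting `ε → 0` gives the equation in weak form (`integral_sqrt_mul_sumSecondDeriv`). Second, `C
I⁻¹` has full row rank, so `L` is elliptic, and `u ≥ 0` is a continuous weak supersolution. A strong
maximum principle, proved by monotonicity of ellipsoidal means
(`eventually_eq_zero_of_weak_supersolution`), shows that its zero set is open in `int W`. By
connectedness `u > 0` there, so `u` is `C²` and the weak equation holds pointwise. -/

/-! ### Truncated powers and ellipsoidal bumps -/

theorem hasDerivAt_max_zero_pow (j : ℕ) (x : ℝ) :
    HasDerivAt (fun s : ℝ => max s 0 ^ (j + 2)) ((j + 2 : ℕ) * max x 0 ^ (j + 1)) x := by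
  have key : ∀ y : ℝ, y ≠ 0 →
      HasDerivAt (fun s : ℝ => max s 0 ^ (j + 2)) ((j + 2 : ℕ) * max y 0 ^ (j + 1)) y := by
    intro y hy
    rcases lt_or_gt_of_ne hy with h | h
    · rw [max_eq_right h.le, zero_pow (Nat.succ_ne_zero j), mul_zero]
      refine (hasDerivAt_const y (0 : ℝ)).congr_of_eventuallyEq ?_
      filter_upwards [eventually_lt_nhds h] with s hs
      rw [max_eq_right hs.le, zero_pow (by omega)]
    · rw [max_eq_left h.le]
      refine (hasDerivAt_pow (j + 2) y).congr_of_eventuallyEq ?_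
      filter_upwards [eventually_gt_nhds h] with s hs
      rw [max_eq_left hs.le]
  by_cases hx : x = 0
  · subst hx
    -- At the kink: function and candidate derivative are continuous, and the formula holds off `0`.
    exact hasDerivAt_of_hasDerivAt_of_ne (fun y hy => key y hy)
      (by fun_prop) (by fun_prop)
  · exact key x hx

theorem contDiff_max_zero_pow (j : ℕ) : ContDiff ℝ j (fun s : ℝ => max s 0 ^ (j + 1)) := by
  induction j with
  | zero => exact contDiff_zero.2 (by fun_prop)
  | succ j ih =>
    rw [show ((j + 1 : ℕ) : WithTop ℕ∞) = (j : WithTop ℕ∞) + 1 by push_cast; rfl,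
      contDiff_succ_iff_deriv]
    refine ⟨fun x => (hasDerivAt_max_zero_pow j x).differentiableAt, by simp, ?_⟩
    rw [show deriv (fun s : ℝ => max s 0 ^ (j + 1 + 1)) =
      fun x => ((j + 2 : ℕ) : ℝ) * max x 0 ^ (j + 1) from
        funext fun x => (hasDerivAt_max_zero_pow j x).deriv]
    exact contDiff_const.mul ih

section
variable {E ι : Type*} [NormedAddCommGroup E] [NormedSpace ℝ E] [Fintype ι]

/-- The constant-coefficient second order operator `∑ a, ∂²φ/∂v_a²`. -/
noncomputable def sumSecondDeriv (v : ι → E) (φ : E → ℝ) (x : E) : ℝ :=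
  ∑ a, fderiv ℝ (fun y => fderiv ℝ φ y (v a)) x (v a)

/-- The bump `(1 - B(y - x₀, y - x₀) / d ^ 2)₊ ^ j`. -/
noncomputable def quadBump (B : E →L[ℝ] E →L[ℝ] ℝ) (x₀ : E) (d : ℝ) (j : ℕ) (y : E) : ℝ :=
  max (1 - B (y - x₀) (y - x₀) / d ^ 2) 0 ^ j

variable {B : E →L[ℝ] E →L[ℝ] ℝ} {x₀ : E} {d : ℝ}

theorem quadBump_nonneg (j : ℕ) (y : E) : 0 ≤ quadBump B x₀ d j y :=
  pow_nonneg (le_max_right _ _) j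

theorem hasFDerivAt_quadBump (hB : ∀ x y, B x y = B y x) (j : ℕ) (y : E) :
    HasFDerivAt (quadBump B x₀ d (j + 2))
      ((-(2 * (j + 2 : ℕ) / d ^ 2) * quadBump B x₀ d (j + 1) y) • B (y - x₀)) y := by
  have h1 : HasFDerivAt (fun y : E => y - x₀) (ContinuousLinearMap.id ℝ E) y :=
    (hasFDerivAt_id y).sub_const x₀
  have h2 := ((B.isBoundedBilinearMap).hasFDerivAt (y - x₀, y - x₀)).comp y (h1.prodMk h1)
  have h3 := ((h2.mul_const (d ^ 2)⁻¹).const_sub 1)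
  have h4 := (hasDerivAt_max_zero_pow j (1 - B (y - x₀) (y - x₀) / d ^ 2)).comp_hasFDerivAt y
    (f := fun y : E => 1 - B (y - x₀) (y - x₀) / d ^ 2)
    (h3.congr_of_eventuallyEq (Filter.Eventually.of_forall fun z => by
      simp [div_eq_mul_inv]))
  refine h4.congr_fderiv ?_
  ext z
  simp [quadBump, hB z (y - x₀)]
  ring

theorem contDiff_quadBump (j : ℕ) : ContDiff ℝ j (quadBump B x₀ d (j + 1)) := by
  have : ContDiff ℝ j (fun y : E => 1 - B (y - x₀) (y - x₀) / d ^ 2) := by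
    have h1 : ContDiff ℝ j (fun y : E => y - x₀) := contDiff_id.sub contDiff_const
    exact contDiff_const.sub (((B.contDiff.comp h1).clm_apply h1).div_const _)
  exact (contDiff_max_zero_pow j).comp this

theorem continuous_quadBump (j : ℕ) : Continuous (quadBump B x₀ d j) := by
  unfold quadBump
  fun_prop

theorem sumSecondDeriv_quadBump (hB : ∀ x y, B x y = B y x) (v : ι → E) (y : E) :
    sumSecondDeriv v (quadBump B x₀ d 4) y =
      48 / d ^ 4 * quadBump B x₀ d 2 y * ∑ a, B (y - x₀) (v a) ^ 2 -
        8 / d ^ 2 * quadBump B x₀ d 3 y * ∑ a, B (v a) (v a) := by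
  have : ∀ a, fderiv ℝ (fun y => fderiv ℝ (quadBump B x₀ d 4) y (v a)) y (v a) =
      48 / d ^ 4 * quadBump B x₀ d 2 y * B (y - x₀) (v a) ^ 2 -
        8 / d ^ 2 * quadBump B x₀ d 3 y * B (v a) (v a) := by
    intro a
    have e : (fun y => fderiv ℝ (quadBump B x₀ d 4) y (v a)) =
        fun y => quadBump B x₀ d 3 y * (-(8 / d ^ 2) * B (y - x₀) (v a)) := by
      funext z
      rw [(hasFDerivAt_quadBump hB 2 z).fderiv]
      simp
      ring
    have h1 : HasFDerivAt (fun y : E => B (y - x₀) (v a)) (B.flip (v a)) y := by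
      have := (B.flip (v a)).hasFDerivAt (x := y - x₀) |>.comp y ((hasFDerivAt_id y).sub_const x₀)
      exact this.congr_fderiv (by ext; simp)
    have h2 := (hasFDerivAt_quadBump (d := d) (x₀ := x₀) hB 1 y).fun_mul
      (h1.const_mul (-(8 / d ^ 2)))
    rw [e, h2.fderiv]
    simp
    ring
  rw [sumSecondDeriv, Finset.sum_congr rfl fun a _ => this a, Finset.sum_sub_distrib,
    ← Finset.mul_sum, ← Finset.mul_sum]

theorem quadBump_eq_zero {j : ℕ} (hj : j ≠ 0) (hd : 0 < d) {y : E}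
    (h : d ^ 2 ≤ B (y - x₀) (y - x₀)) : quadBump B x₀ d j y = 0 := by
  have : 1 ≤ B (y - x₀) (y - x₀) / d ^ 2 := by rwa [one_le_div (by positivity)]
  rw [quadBump, max_eq_right (by linarith), zero_pow hj]

/-- The derivative in the scale `d` of the normalised bump is, up to a positive factor,
the operator applied to the next bump. -/
theorem hasDerivAt_quadBump_scale (hB : ∀ x y, B x y = B y x) (v : ι → E) {N : ℕ}
    (htr : ∑ a, B (v a) (v a) = N) (hq : ∀ x, ∑ a, B x (v a) ^ 2 = B x x) (hd : 0 < d) (y : E) :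
    HasDerivAt (fun r : ℝ => (r ^ N)⁻¹ * quadBump B x₀ r 3 y)
      ((d ^ N)⁻¹ * (d / 8 * sumSecondDeriv v (quadBump B x₀ d 4) y)) d := by
  have h1 : HasDerivAt (fun r : ℝ => 1 - B (y - x₀) (y - x₀) / r ^ 2)
      (2 * B (y - x₀) (y - x₀) / d ^ 3) d := by
    have := (((hasDerivAt_pow 2 d).inv (by positivity)).const_mul
      (B (y - x₀) (y - x₀))).const_sub 1
    refine (this.congr_deriv ?_)
    simp only [Nat.cast_ofNat]
    field_simp
    norm_num
  have h2 := (hasDerivAt_max_zero_pow 1 (1 - B (y - x₀) (y - x₀) / d ^ 2)).comp d h1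
  have h3 : HasDerivAt (fun r : ℝ => (r ^ N)⁻¹) (-(N : ℝ) * (d ^ N)⁻¹ / d) d := by
    refine ((hasDerivAt_pow N d).inv (by positivity)).congr_deriv ?_
    rcases N with _ | N
    · simp
    · simp only [Nat.add_sub_cancel]
      field_simp
      ring
  refine (h3.mul h2).congr_deriv ?_
  -- With `q = B(y - x₀, y - x₀)` and `b = (1 - q / d²)₊`, the normalisations `htr` and `hq` make
  -- both sides `d⁻ᴺ (6 q b² / d³ - N b³ / d)`.
  rw [sumSecondDeriv_quadBump hB, htr, hq]
  simp only [Function.comp, quadBump]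
  field_simp
  push_cast
  ring
end

/-! ### Strong maximum principle for weak supersolutions -/

section
variable {E ι : Type*} [NormedAddCommGroup E] [NormedSpace ℝ E] [Fintype ι]
  {B : E →L[ℝ] E →L[ℝ] ℝ} {x₀ : E} {c d r : ℝ}

/-- Coercivity places the ellipsoid `B < d²` in a ball of radius `d / √c`; this is the source of the
range `d ≤ √c r` of admissible scales. -/
theorem quadBump_eq_zero_of_notMem_closedBall (hc : 0 < c) (hcB : ∀ x, c * ‖x‖ ^ 2 ≤ B x x)
    {j : ℕ} (hj : j ≠ 0) (hr : 0 ≤ r) (hd : 0 < d) (hdr : d ≤ Real.sqrt c * r) {y : E}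
    (hy : y ∉ Metric.closedBall x₀ r) : quadBump B x₀ d j y = 0 := by
  refine quadBump_eq_zero hj hd ((pow_le_pow_left₀ hd.le hdr 2).trans ?_)
  rw [mul_pow, Real.sq_sqrt hc.le]
  refine le_trans ?_ (hcB _)
  rw [Metric.mem_closedBall, not_le, dist_eq_norm] at hy
  gcongr

theorem tsupport_quadBump_subset (hc : 0 < c) (hcB : ∀ x, c * ‖x‖ ^ 2 ≤ B x x)
    {j : ℕ} (hj : j ≠ 0) (hr : 0 ≤ r) (hd : 0 < d) (hdr : d ≤ Real.sqrt c * r) :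
    tsupport (quadBump B x₀ d j) ⊆ Metric.closedBall x₀ r := by
  refine closure_minimal (fun y hy => ?_) Metric.isClosed_closedBall
  by_contra h
  exact hy (quadBump_eq_zero_of_notMem_closedBall hc hcB hj hr hd hdr h)

variable [FiniteDimensional ℝ E] [MeasurableSpace E] [BorelSpace E] {μ : Measure E}
  [μ.IsAddHaarMeasure]

theorem hasDerivAt_integral_mul_quadBump (hB : ∀ x y, B x y = B y x) (hc : 0 < c)
    (hcB : ∀ x, c * ‖x‖ ^ 2 ≤ B x x) (v : ι → E) {N : ℕ} (htr : ∑ a, B (v a) (v a) = N)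
    (hq : ∀ x, ∑ a, B x (v a) ^ 2 = B x x) {u : E → ℝ} (hu : Continuous u) (hr : 0 ≤ r)
    (hd : 0 < d) (hdr : d < Real.sqrt c * r) :
    HasDerivAt (fun s : ℝ => ∫ y, u y * ((s ^ N)⁻¹ * quadBump B x₀ s 3 y) ∂μ)
      (∫ y, u y * ((d ^ N)⁻¹ * (d / 8 * sumSecondDeriv v (quadBump B x₀ d 4) y)) ∂μ) d := by
  have hK : IsCompact (Metric.closedBall x₀ r) := isCompact_closedBall x₀ r
  -- Scales stay above `d / 2`, away from the singularity of `s⁻ᴺ`; compactness then gives a uniform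
  -- bound on the derivative.
  have hcont : ContinuousOn (fun z : ℝ × E => u z.2 * ((z.1 ^ N)⁻¹ *
      (z.1 / 8 * sumSecondDeriv v (quadBump B x₀ z.1 4) z.2)))
      (Set.Icc (d / 2) (Real.sqrt c * r) ×ˢ Metric.closedBall x₀ r) := by
    simp only [sumSecondDeriv_quadBump hB, quadBump]
    intro z hz
    have hz0 : 0 < z.1 := by linarith [hz.1.1]
    refine ContinuousAt.continuousWithinAt ?_
    fun_prop (disch := positivity)
  obtain ⟨M, hM⟩ := (isCompact_Icc.prod hK).exists_bound_of_continuousOn hcont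
  have hs : Set.Ioo (d / 2) (Real.sqrt c * r) ∈ nhds d := Ioo_mem_nhds (by linarith) hdr
  refine (hasDerivAt_integral_of_dominated_loc_of_deriv_le
    (F := fun s y => u y * ((s ^ N)⁻¹ * quadBump B x₀ s 3 y))
    (F' := fun s y => u y * ((s ^ N)⁻¹ * (s / 8 * sumSecondDeriv v (quadBump B x₀ s 4) y)))
    (bound := (Metric.closedBall x₀ r).indicator fun _ => M) hs ?_ ?_ ?_ ?_ ?_ ?_).2
  · refine Filter.Eventually.of_forall fun s => Continuous.aestronglyMeasurable ?_
    have := continuous_quadBump (B := B) (x₀ := x₀) (d := s) 3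
    fun_prop
  · refine Continuous.integrable_of_hasCompactSupport ?_ ?_
    · have := continuous_quadBump (B := B) (x₀ := x₀) (d := d) 3
      fun_prop
    · refine HasCompactSupport.of_support_subset_isCompact hK fun y hy => ?_
      by_contra h
      exact hy (by
        simp only [quadBump_eq_zero_of_notMem_closedBall hc hcB three_ne_zero hr hd hdr.le h,
          mul_zero])
  · refine Continuous.aestronglyMeasurable ?_
    simp only [sumSecondDeriv_quadBump hB]
    have h3 := continuous_quadBump (B := B) (x₀ := x₀) (d := d) 3
    have h2 := continuous_quadBump (B := B) (x₀ := x₀) (d := d) 2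
    fun_prop
  · refine Filter.Eventually.of_forall fun y s hs => ?_
    by_cases hy : y ∈ Metric.closedBall x₀ r
    · rw [Set.indicator_of_mem hy]
      exact hM (s, y) ⟨Set.Ioo_subset_Icc_self hs, hy⟩
    · have hs0 : 0 < s := by linarith [hs.1]
      rw [Set.indicator_of_notMem hy, sumSecondDeriv_quadBump hB,
        quadBump_eq_zero_of_notMem_closedBall hc hcB three_ne_zero hr hs0 hs.2.le hy,
        quadBump_eq_zero_of_notMem_closedBall hc hcB two_ne_zero hr hs0 hs.2.le hy]
      simp
  · exact (integrable_indicator_iff Metric.isClosed_closedBall.measurableSet).2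
      (integrableOn_const hK.measure_lt_top.ne)
  · refine Filter.Eventually.of_forall fun y s hs => ?_
    exact (hasDerivAt_quadBump_scale hB v htr hq (by linarith [hs.1]) y).const_mul _

/-- The substitution `y = x₀ + d z` leaves `d` only inside `u`, over a fixed compact ball, which
gives access to the limit `d → 0`. -/
theorem integral_mul_quadBump_eq (hc : 0 < c) (hcB : ∀ x, c * ‖x‖ ^ 2 ≤ B x x) (u : E → ℝ)
    (hd : 0 < d) :
    ∫ y, u y * ((d ^ Module.finrank ℝ E)⁻¹ * quadBump B x₀ d 3 y) ∂μ =
      ∫ z in Metric.closedBall (0 : E) (Real.sqrt c)⁻¹,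
        u (x₀ + d • z) * quadBump B 0 1 3 z ∂μ := by
  rw [setIntegral_eq_integral_of_forall_compl_eq_zero]
  · have h1 := Measure.integral_comp_smul μ
      (fun y => u (x₀ + y) * quadBump B x₀ d 3 (x₀ + y)) d
    have h2 := integral_add_left_eq_self (μ := μ) (fun y => u y * quadBump B x₀ d 3 y) x₀
    rw [h2, abs_of_pos (by positivity)] at h1
    have h3 : ∀ y, u y * ((d ^ Module.finrank ℝ E)⁻¹ * quadBump B x₀ d 3 y) =
      (d ^ Module.finrank ℝ E)⁻¹ * (u y * quadBump B x₀ d 3 y) := fun y => by ring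
    simp only [h3]
    rw [integral_const_mul, ← smul_eq_mul, ← h1]
    refine integral_congr_ae (Filter.Eventually.of_forall fun z => ?_)
    simp only [quadBump, add_sub_cancel_left, map_smul, smul_eq_mul,
      _root_.smul_apply, sub_zero]
    congr 4
    field_simp
  · intro z hz
    rw [quadBump_eq_zero_of_notMem_closedBall hc hcB three_ne_zero (by positivity) one_pos ?_ hz,
      mul_zero]
    rw [mul_inv_cancel₀ (by positivity)]

/-- Strong maximum principle for continuous weak supersolutions of a constant-coefficient
elliptic operator: the zero set of a nonnegative supersolution is open. -/
theorem eventually_eq_zero_of_weak_supersolution (hB : ∀ x y, B x y = B y x) (hc : 0 < c)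
    (hcB : ∀ x, c * ‖x‖ ^ 2 ≤ B x x) (v : ι → E)
    (htr : ∑ a, B (v a) (v a) = Module.finrank ℝ E)
    (hq : ∀ x, ∑ a, B x (v a) ^ 2 = B x x) {u : E → ℝ} (hu : Continuous u) (hu0 : ∀ x, 0 ≤ u x)
    {Ω : Set E} (hΩ : IsOpen Ω) (hx : x₀ ∈ Ω) (hux : u x₀ = 0)
    (hweak : ∀ φ : E → ℝ, ContDiff ℝ 2 φ → HasCompactSupport φ → tsupport φ ⊆ Ω →
      (∀ x, 0 ≤ φ x) → ∫ y, u y * sumSecondDeriv v φ y ∂μ ≤ 0) :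
    ∀ᶠ y in nhds x₀, u y = 0 := by
  obtain ⟨r, hr, hrΩ⟩ := Metric.nhds_basis_closedBall.mem_iff.1 (hΩ.mem_nhds hx)
  have hR : 0 < Real.sqrt c * r := by positivity
  have hder := fun (d : ℝ) (hd : d ∈ Set.Ioo 0 (Real.sqrt c * r)) =>
    hasDerivAt_integral_mul_quadBump (μ := μ) (x₀ := x₀) hB hc hcB v htr hq hu hr.le hd.1 hd.2
  -- The scale derivative of the mean is a positive multiple of `∫ u L(bump)`, which is nonpositive
  -- for a supersolution.
  have hanti : AntitoneOn (fun s : ℝ =>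
      ∫ y, u y * ((s ^ Module.finrank ℝ E)⁻¹ * quadBump B x₀ s 3 y) ∂μ)
      (Set.Ioo 0 (Real.sqrt c * r)) := by
    refine antitoneOn_of_deriv_nonpos (convex_Ioo _ _)
      (fun d hd => (hder d hd).continuousAt.continuousWithinAt) ?_ ?_ <;> rw [interior_Ioo]
    · exact fun d hd => (hder d hd).differentiableAt.differentiableWithinAt
    · intro d hd
      have hsub := tsupport_quadBump_subset (x₀ := x₀) hc hcB four_ne_zero hr.le hd.1 hd.2.le
      have := hweak (quadBump B x₀ d 4) ((contDiff_quadBump 3).of_le (by norm_num))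
        ((isCompact_closedBall x₀ r).of_isClosed_subset (isClosed_tsupport _) hsub)
        (hsub.trans hrΩ) (quadBump_nonneg 4)
      have e : ∀ y, u y * ((d ^ Module.finrank ℝ E)⁻¹ *
          (d / 8 * sumSecondDeriv v (quadBump B x₀ d 4) y)) =
          ((d ^ Module.finrank ℝ E)⁻¹ * (d / 8)) *
            (u y * sumSecondDeriv v (quadBump B x₀ d 4) y) := fun y => by ring
      rw [(hder d hd).deriv]
      simp only [e]
      rw [integral_const_mul]
      have := hd.1
      exact mul_nonpos_of_nonneg_of_nonpos (by positivity) ‹_›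
  -- As the scale shrinks, the means tend to a multiple of `u x₀ = 0`.
  have hlim : Filter.Tendsto (fun s : ℝ =>
      ∫ y, u y * ((s ^ Module.finrank ℝ E)⁻¹ * quadBump B x₀ s 3 y) ∂μ)
      (nhdsWithin 0 (Set.Ioi 0)) (nhds 0) := by
    have hc0 : Continuous fun s : ℝ => ∫ z in Metric.closedBall (0 : E) (Real.sqrt c)⁻¹,
        u (x₀ + s • z) * quadBump B 0 1 3 z ∂μ := by
      refine continuous_parametric_integral_of_continuous ?_ (isCompact_closedBall _ _)
      have := continuous_quadBump (B := B) (x₀ := 0) (d := 1) 3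
      simp only [Function.uncurry_def]
      fun_prop
    have h0 := (hc0.tendsto 0).mono_left (nhdsWithin_le_nhds (s := Set.Ioi (0 : ℝ)))
    simp only [zero_smul, add_zero, hux, zero_mul, integral_zero] at h0
    refine h0.congr' ?_
    filter_upwards [self_mem_nhdsWithin] with s hs
    exact (integral_mul_quadBump_eq hc hcB u hs).symm
  set d := Real.sqrt c * r / 2 with hd
  have hd0 : 0 < d := by positivity
  have hdR : d < Real.sqrt c * r := by linarith
  -- Being nonincreasing with limit `0` at scale `0`, the mean is nonpositive; its integrand is
  -- nonnegative, so it vanishes identically.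
  have hle : ∫ y, u y * ((d ^ Module.finrank ℝ E)⁻¹ * quadBump B x₀ d 3 y) ∂μ ≤ 0 := by
    refine ge_of_tendsto hlim ?_
    filter_upwards [Ioo_mem_nhdsGT hd0] with s hs
    exact hanti ⟨hs.1, hs.2.trans hdR⟩ ⟨hd0, hdR⟩ hs.2.le
  have hcont : Continuous fun y => u y * ((d ^ Module.finrank ℝ E)⁻¹ * quadBump B x₀ d 3 y) := by
    have := continuous_quadBump (B := B) (x₀ := x₀) (d := d) 3
    fun_prop
  have hnn : ∀ y, 0 ≤ u y * ((d ^ Module.finrank ℝ E)⁻¹ * quadBump B x₀ d 3 y) := fun y =>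
    mul_nonneg (hu0 y) (mul_nonneg (by positivity) (quadBump_nonneg 3 y))
  have hsupp : HasCompactSupport
      fun y => u y * ((d ^ Module.finrank ℝ E)⁻¹ * quadBump B x₀ d 3 y) := by
    refine HasCompactSupport.of_support_subset_isCompact (isCompact_closedBall x₀ r) fun y hy => ?_
    by_contra h
    exact hy (by
      simp only [quadBump_eq_zero_of_notMem_closedBall hc hcB three_ne_zero hr.le hd0 hdR.le h,
        mul_zero])
  have hzero : ∀ y, u y * ((d ^ Module.finrank ℝ E)⁻¹ * quadBump B x₀ d 3 y) = 0 := by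
    by_contra! h
    obtain ⟨y, hy⟩ := h
    exact absurd (hcont.integral_pos_of_hasCompactSupport_nonneg_nonzero (μ := μ) hsupp hnn hy)
      (not_lt.2 hle)
  have hpos : ∀ᶠ y in nhds x₀, 0 < quadBump B x₀ d 3 y := by
    refine (continuous_quadBump 3).continuousAt.eventually_const_lt ?_
    simp [quadBump]
  filter_upwards [hpos] with y hy
  rcases mul_eq_zero.1 (hzero y) with h | h
  · exact h
  · exact absurd h (by positivity)
end

/-! ### The Fisher information as a matrix of the noise alone -/

section
-- Two closed sets cover the space, `closure W` and `closure Wᶜ`; on the second `g` is zero, because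
-- its points in `W` lie on the frontier.
theorem continuous_of_continuousOn_closure {α : Type*} [TopologicalSpace α] {W : Set α}
    {g : α → ℝ} (hc : ContinuousOn g (closure W)) (h0 : ∀ w, w ∉ W → g w = 0)
    (hb : ∀ w ∈ frontier W, g w = 0) : Continuous g := by
  have h1 : ∀ w ∈ closure Wᶜ, g w = 0 := by
    intro w hw
    by_cases h : w ∈ W
    · exact hb w (by rw [frontier_eq_closure_inter_closure]; exact ⟨subset_closure h, hw⟩)
    · exact h0 w h
  have h2 : ContinuousOn g (closure Wᶜ) := continuousOn_const.congr h1
  rw [← continuousOn_univ]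
  refine (hc.union_of_isClosed h2 isClosed_closure isClosed_closure).mono fun w _ => ?_
  by_cases h : w ∈ W
  · exact Or.inl (subset_closure h)
  · exact Or.inr (subset_closure h)

theorem mem_interior_of_ne_zero {α : Type*} [TopologicalSpace α] {W : Set α} {g : α → ℝ}
    (h0 : ∀ w, w ∉ W → g w = 0) (hb : ∀ w ∈ frontier W, g w = 0) {w : α} (hw : g w ≠ 0) :
    w ∈ interior W := by
  have h1 : w ∈ W := by_contra fun h => hw (h0 w h)
  by_contra h
  exact hw (hb w ⟨subset_closure h1, h⟩)

/-- A zero is a minimum; where `g` is not differentiable, `fderiv` is `0` by default. -/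
theorem fderiv_eq_zero_of_nonneg {E : Type*} [NormedAddCommGroup E] [NormedSpace ℝ E]
    {g : E → ℝ} (hg : ∀ w, 0 ≤ g w) {w : E} (hw : g w = 0) : fderiv ℝ g w = 0 :=
  IsLocalMin.fderiv_eq_zero (Filter.Eventually.of_forall fun y => by rw [hw]; exact hg y)

/-- The density of the Fisher information of the translates of `η`, in the directions `a`, `b`. -/
noncomputable def fisherForm {E : Type*} [NormedAddCommGroup E] [NormedSpace ℝ E] (η : E → ℝ)
    (a b w : E) : ℝ :=
  fderiv ℝ η w a * fderiv ℝ η w b / η w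

variable {m n : ℕ}

/-- The linear query, as a linear map on coordinate vectors. -/
noncomputable def queryLin (C : Matrix (Fin m) (Fin n) ℝ) :
    (Fin n → ℝ) →ₗ[ℝ] EuclideanSpace ℝ (Fin m) :=
  (WithLp.linearEquiv 2 ℝ (Fin m → ℝ)).symm.toLinearMap ∘ₗ C.mulVecLin

theorem hasFDerivAt_linearQuery (C : Matrix (Fin m) (Fin n) ℝ) (x : EuclideanSpace ℝ (Fin n)) :
    HasFDerivAt (linearQuery C) (LinearMap.toContinuousLinearMap
      (queryLin C ∘ₗ (WithLp.linearEquiv 2 ℝ (Fin n → ℝ)).toLinearMap)) x :=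
  (LinearMap.toContinuousLinearMap
      (queryLin C ∘ₗ (WithLp.linearEquiv 2 ℝ (Fin n → ℝ)).toLinearMap)).hasFDerivAt

/-- The matrix of the Fisher information in terms of the noise variable. -/
noncomputable def noiseFisher (C : Matrix (Fin m) (Fin n) ℝ) (η : EuclideanSpace ℝ (Fin m) → ℝ) :
    Matrix (Fin n) (Fin n) ℝ :=
  Matrix.of fun i j => ∫ w, fisherForm η (queryLin C (Pi.single i 1)) (queryLin C (Pi.single j 1)) w

variable {C : Matrix (Fin m) (Fin n) ℝ} {η : EuclideanSpace ℝ (Fin m) → ℝ}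

/-- The two signs from differentiating `y - C x` cancel. Where the density vanishes, both sides are
`0`, on the right because division by zero gives `0`. -/
theorem fisherIntegrand_linearQuery
    (hd : ∀ w, η w ≠ 0 → DifferentiableAt ℝ η w) (x : EuclideanSpace ℝ (Fin n)) (i j : Fin n)
    (y : EuclideanSpace ℝ (Fin m)) :
    fisherIntegrand (linearQuery C) η x i j y =
      fisherForm η (queryLin C (Pi.single i 1)) (queryLin C (Pi.single j 1))
        (y - linearQuery C x) := by
  unfold fisherIntegrand fisherForm responseDensity
  by_cases hy : η (y - linearQuery C x) = 0
  · simp [hy]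
  · have h1 : ∀ i, score (linearQuery C) η y x i =
        -(fderiv ℝ η (y - linearQuery C x) (queryLin C (Pi.single i 1)) /
          η (y - linearQuery C x)) := by
      intro i
      have h2 := ((hd _ hy).hasFDerivAt.comp x
        ((hasFDerivAt_linearQuery C x).const_sub y)).log hy
      unfold score responseDensity
      have h3 := h2.fderiv
      simp only [Function.comp_def] at h3
      rw [h3]
      have h4 : (WithLp.linearEquiv 2 ℝ (Fin n → ℝ)) (EuclideanSpace.single i (1 : ℝ)) =
        Pi.single i 1 := by ext; simp [Pi.single_apply]
      simp [h4]
      ring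
    rw [h1, h1]
    field_simp

variable {W : Set (EuclideanSpace ℝ (Fin m))}

theorem fisherIntegrand_eq_zero_of_notMem (hW : ∀ w, w ∉ W → η w = 0)
    (x : EuclideanSpace ℝ (Fin n)) (i j : Fin n) {y : EuclideanSpace ℝ (Fin m)}
    (hy : y ∉ responseSet (linearQuery C) W x) : fisherIntegrand (linearQuery C) η x i j y = 0 := by
  unfold fisherIntegrand responseDensity
  rw [hW, zero_mul]
  exact fun h => hy ⟨_, h, add_sub_cancel _ _⟩

/-- The integrand vanishes off the response set, so the integral is over the whole space, and the
shift `w = y - C x` removes `x`. -/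
theorem fisherInformation_linearQuery (hW : ∀ w, w ∉ W → η w = 0)
    (hd : ∀ w, η w ≠ 0 → DifferentiableAt ℝ η w) (x : EuclideanSpace ℝ (Fin n)) :
    fisherInformation (linearQuery C) W η x = noiseFisher C η := by
  ext i j
  simp only [fisherInformation, noiseFisher, Matrix.of_apply]
  rw [setIntegral_eq_integral_of_forall_compl_eq_zero
    fun y hy => fisherIntegrand_eq_zero_of_notMem hW x i j hy]
  simp only [fisherIntegrand_linearQuery hd]
  exact integral_sub_right_eq_self _ (linearQuery C x)

theorem integrableOn_fisherIntegrand_iff (hW : ∀ w, w ∉ W → η w = 0)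
    (hd : ∀ w, η w ≠ 0 → DifferentiableAt ℝ η w) (x : EuclideanSpace ℝ (Fin n)) (i j : Fin n) :
    IntegrableOn (fisherIntegrand (linearQuery C) η x i j) (responseSet (linearQuery C) W x) ↔
      Integrable (fisherForm η (queryLin C (Pi.single i 1)) (queryLin C (Pi.single j 1))) := by
  rw [integrableOn_iff_integrable_of_support_subset]
  · rw [funext (fisherIntegrand_linearQuery hd x i j)]
    refine ⟨fun h => ?_, fun h => h.comp_sub_right _⟩
    simpa using h.comp_add_right (linearQuery C x)
  · intro y hy
    by_contra h
    exact hy (fisherIntegrand_eq_zero_of_notMem hW x i j h)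

theorem hasRegularFisher_iff (hW : ∀ w, w ∉ W → η w = 0)
    (hd : ∀ w, η w ≠ 0 → DifferentiableAt ℝ η w) (x : EuclideanSpace ℝ (Fin n)) :
    HasRegularFisher (linearQuery C) W η x ↔
      (∀ i j, Integrable
        (fisherForm η (queryLin C (Pi.single i 1)) (queryLin C (Pi.single j 1)))) ∧
        IsUnit (noiseFisher C η) := by
  refine ⟨fun h => ⟨fun i j => ?_, ?_⟩, fun h => ⟨fun i j => ?_, ?_⟩⟩
  · exact (integrableOn_fisherIntegrand_iff hW hd x i j).1 (h.integrable i j)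
  · exact fisherInformation_linearQuery hW hd x ▸ h.invertible
  · exact (integrableOn_fisherIntegrand_iff hW hd x i j).2 (h.1 i j)
  · exact (fisherInformation_linearQuery hW hd x).symm ▸ h.2

theorem fisherForm_queryLin (z z' : Fin n → ℝ) (w : EuclideanSpace ℝ (Fin m)) :
    fisherForm η (queryLin C z) (queryLin C z') w = ∑ i, ∑ j, z i * z' j *
      fisherForm η (queryLin C (Pi.single i 1)) (queryLin C (Pi.single j 1)) w := by
  have h : ∀ z : Fin n → ℝ, fderiv ℝ η w (queryLin C z) =
      ∑ i, z i * fderiv ℝ η w (queryLin C (Pi.single i 1)) := by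
    intro z
    conv_lhs => rw [pi_eq_sum_univ' z]
    simp
  unfold fisherForm
  rw [h z, h z', Finset.sum_mul_sum, Finset.sum_div]
  refine Finset.sum_congr rfl fun i _ => ?_
  rw [Finset.sum_div]
  exact Finset.sum_congr rfl fun j _ => by ring

theorem integrable_fisherForm (hi : ∀ i j, Integrable
      (fisherForm η (queryLin C (Pi.single i 1)) (queryLin C (Pi.single j 1))))
    (z z' : Fin n → ℝ) : Integrable (fisherForm η (queryLin C z) (queryLin C z')) := by
  rw [funext (fisherForm_queryLin z z')]
  exact integrable_finsetSum _ fun i _ => integrable_finsetSum _ fun j _ => (hi i j).const_mul _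

theorem integral_fisherForm (hi : ∀ i j, Integrable
      (fisherForm η (queryLin C (Pi.single i 1)) (queryLin C (Pi.single j 1))))
    (z z' : Fin n → ℝ) :
    ∫ w, fisherForm η (queryLin C z) (queryLin C z') w =
      dotProduct z ((noiseFisher C η).mulVec z') := by
  simp only [fisherForm_queryLin z z']
  rw [integral_finsetSum _ fun i _ => integrable_finsetSum _ fun j _ => (hi i j).const_mul _]
  simp only [dotProduct, Matrix.mulVec, Finset.mul_sum]
  refine Finset.sum_congr rfl fun i _ => ?_
  rw [integral_finsetSum _ fun j _ => (hi i j).const_mul _]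
  refine Finset.sum_congr rfl fun j _ => ?_
  rw [integral_const_mul, noiseFisher, Matrix.of_apply]
  ring

theorem posSemidef_noiseFisher (h0 : ∀ w, 0 ≤ η w) (hi : ∀ i j, Integrable
      (fisherForm η (queryLin C (Pi.single i 1)) (queryLin C (Pi.single j 1)))) :
    (noiseFisher C η).PosSemidef := by
  refine Matrix.PosSemidef.of_dotProduct_mulVec_nonneg ?_ fun z => ?_
  · ext i j
    simp [noiseFisher, fisherForm, mul_comm]
  · rw [star_trivial, ← integral_fisherForm hi]
    exact integral_nonneg fun w => div_nonneg (mul_self_nonneg _) (h0 w)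

/-- A continuous integrable function that is constant along a fixed nonzero direction vanishes. -/
theorem eq_zero_of_fderiv_apply_eq_zero {E : Type*} [NormedAddCommGroup E] [NormedSpace ℝ E]
    [FiniteDimensional ℝ E] [MeasurableSpace E] [BorelSpace E] {μ : Measure E}
    [μ.IsAddHaarMeasure] {g : E → ℝ} (hg : Continuous g) (hi : Integrable g μ)
    {e : E} (he : e ≠ 0) (hd : ∀ w, g w ≠ 0 → DifferentiableAt ℝ g w)
    (h : ∀ w, g w ≠ 0 → fderiv ℝ g w e = 0) : ∀ w, g w = 0 := by
  -- The parameters with value `g w` form a closed set, and an open one because `g` stays nonzero,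
  -- hence locally constant, along the line there.
  have hline : ∀ w, g w ≠ 0 → ∀ t : ℝ, g (w + t • e) = g w := by
    intro w hw
    have hcont : Continuous fun t : ℝ => g (w + t • e) := by fun_prop
    have hclopen : IsClopen {t : ℝ | g (w + t • e) = g w} := by
      refine ⟨isClosed_eq hcont continuous_const, ?_⟩
      rw [isOpen_iff_mem_nhds]
      intro t ht
      have hne : ∀ᶠ s in nhds t, g (w + s • e) ≠ 0 :=
        hcont.continuousAt.eventually_ne (by rw [show g (w + t • e) = g w from ht]; exact hw)
      obtain ⟨δ, hδ, hball⟩ := Metric.eventually_nhds_iff_ball.1 hne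
      filter_upwards [Metric.ball_mem_nhds t hδ] with s hs
      have hder : ∀ r ∈ Metric.ball t δ, HasDerivAt (fun t : ℝ => g (w + t • e)) 0 r := by
        intro r hr
        have h1 : HasDerivAt (fun t : ℝ => w + t • e) e r := by
          simpa using ((hasDerivAt_id r).smul_const e).const_add w
        have h2 := (hd _ (hball r hr)).hasFDerivAt.comp_hasDerivAt r h1
        rwa [h _ (hball r hr)] at h2
      have := (convex_ball t δ).is_const_of_fderivWithin_eq_zero (𝕜 := ℝ)
        (f := fun t : ℝ => g (w + t • e))
        (fun r hr => (hder r hr).differentiableAt.differentiableWithinAt)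
        (fun r hr => by
          rw [fderivWithin_of_isOpen Metric.isOpen_ball hr]
          ext
          simp [(hder r hr).hasFDerivAt.fderiv]) hs (Metric.mem_ball_self hδ)
      exact this.trans ht
    have huniv := hclopen.eq_univ ⟨0, by simp⟩
    intro t
    have : t ∈ {t : ℝ | g (w + t • e) = g w} := huniv ▸ Set.mem_univ t
    exact this
  intro w
  by_contra hw
  have hev : ∀ᶠ y in nhds w, |g w| / 2 < |g y| :=
    hg.abs.continuousAt.eventually_const_lt (by have := abs_pos.2 hw; linarith)
  obtain ⟨δ, hδ, hball⟩ := Metric.eventually_nhds_iff_ball.1 hev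
  have hepos : 0 < ‖e‖ := norm_pos_iff.2 he
  -- Centres `2δ` apart give disjoint balls of equal measure, each carrying a fixed amount of `∫
  -- |g|`, which contradicts integrability.
  set s : ℕ → Set E := fun k => Metric.ball (w + (k * (2 * δ / ‖e‖)) • e) δ with hs
  have hdisj : Pairwise (Function.onFun Disjoint s) := by
    intro k l hkl
    refine Metric.ball_disjoint_ball ?_
    rw [dist_add_left, dist_eq_norm, ← sub_smul, norm_smul, ← sub_mul, norm_mul,
      Real.norm_of_nonneg (by positivity : 0 ≤ 2 * δ / ‖e‖), mul_assoc, div_mul_cancel₀ _ hepos.ne']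
    have : (1 : ℝ) ≤ ‖(k : ℝ) - l‖ := by
      have h1 : (1 : ℤ) ≤ |(k : ℤ) - l| := Int.one_le_abs (by omega)
      rw [Real.norm_eq_abs]
      exact_mod_cast h1
    nlinarith
  have hsum := (hasSum_integral_iUnion (f := fun y => |g y|) (μ := μ) (s := s)
    (fun k => Metric.isOpen_ball.measurableSet) hdisj hi.abs.integrableOn).summable
  have hge : ∀ k, μ.real (Metric.ball w δ) * (|g w| / 2) ≤ ∫ y in s k, |g y| ∂μ := by
    intro k
    have hv : μ.real (s k) = μ.real (Metric.ball w δ) := by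
      simp only [hs, Measure.real, Measure.addHaar_ball_center]
    rw [← hv, ← smul_eq_mul, ← setIntegral_const]
    refine setIntegral_mono_on (integrableOn_const measure_ball_lt_top.ne) hi.abs.integrableOn
      Metric.isOpen_ball.measurableSet fun y hy => ?_
    have hy' : y - (k * (2 * δ / ‖e‖)) • e ∈ Metric.ball w δ := by
      rw [hs, Metric.mem_ball, dist_eq_norm] at hy
      rw [Metric.mem_ball, dist_eq_norm]
      convert hy using 2
      abel
    have h1 := hball _ hy'
    have h2 := hline (y - (k * (2 * δ / ‖e‖)) • e)
      (abs_pos.1 ((by positivity : 0 ≤ |g w| / 2).trans_lt h1)) (k * (2 * δ / ‖e‖))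
    rw [sub_add_cancel] at h2
    rw [h2]
    exact h1.le
  have hpos : 0 < μ.real (Metric.ball w δ) * (|g w| / 2) := by
    have := abs_pos.2 hw
    have : 0 < μ.real (Metric.ball w δ) :=
      ENNReal.toReal_pos (Metric.measure_ball_pos μ w hδ).ne' measure_ball_lt_top.ne
    positivity
  exact absurd (ge_of_tendsto' hsum.tendsto_atTop_zero hge) (not_le.2 hpos)

/-- For a null vector `z`, `∫ (∂_{Cz} η)² / η = 0`, so by continuity `∂_{Cz} η = 0` wherever `η ≠
0`; an integrable `η` would then vanish. This makes invertibility automatic for the competitors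
below. -/
theorem isUnit_noiseFisher (hC : Function.Injective (queryLin C)) (h0 : ∀ w, 0 ≤ η w)
    (hc : Continuous η) (hint : Integrable η) (hne : ∫ w, η w ≠ 0)
    (hd : ∀ w, η w ≠ 0 → ContDiffAt ℝ 1 η w) (hi : ∀ i j, Integrable
      (fisherForm η (queryLin C (Pi.single i 1)) (queryLin C (Pi.single j 1)))) :
    IsUnit (noiseFisher C η) := by
  rw [Matrix.isUnit_iff_isUnit_det, isUnit_iff_ne_zero]
  intro hdet
  obtain ⟨z, hz, hz0⟩ := Matrix.exists_mulVec_eq_zero_iff.2 hdet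
  have hint0 := integral_fisherForm hi z z
  have hnn : 0 ≤ fisherForm η (queryLin C z) (queryLin C z) :=
    fun w => div_nonneg (mul_self_nonneg _) (h0 w)
  rw [hz0, dotProduct_zero, integral_eq_zero_iff_of_nonneg hnn
    (integrable_fisherForm hi z z)] at hint0
  have hopen : IsOpen {w | η w ≠ 0} := isOpen_ne_fun hc continuous_const
  have hcf : ContinuousOn (fisherForm η (queryLin C z) (queryLin C z)) {w | η w ≠ 0} := by
    intro w hw
    refine ContinuousAt.continuousWithinAt ?_
    have h1 : ContinuousAt (fderiv ℝ η) w :=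
      ((hd w hw).fderiv_right (m := 0) (by norm_num)).continuousAt
    exact ((h1.clm_apply continuousAt_const).mul (h1.clm_apply continuousAt_const)).div
      hc.continuousAt hw
  have heq := Measure.eqOn_open_of_ae_eq (ae_restrict_of_ae hint0) hopen hcf continuousOn_const
  refine hne ?_
  rw [funext (eq_zero_of_fderiv_apply_eq_zero hc hint
    (fun h => hz (hC (h.trans (map_zero _).symm)))
    (fun w hw => (hd w hw).differentiableAt (by norm_num)) fun w hw => ?_), integral_zero]
  have := heq hw
  simp only [fisherForm, Pi.zero_apply, div_eq_zero_iff, mul_self_eq_zero] at this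
  exact this.resolve_right hw
end

/-! ### Convexity: from maximal trace to minimal Dirichlet energy -/

section
theorem nonempty_of_setIntegral_pos {α : Type*} [MeasurableSpace α] {μ : Measure α} {X : Set α}
    {p : α → ℝ} (h : 0 < ∫ x in X, p x ∂μ) : X.Nonempty := by
  by_contra hX
  rw [Set.not_nonempty_iff_eq_empty.1 hX] at h
  simp at h

/-- Expand `0 ≤ Tr((I⁻¹ - J⁻¹) J (I⁻¹ - J⁻¹))`. This is the tangent inequality at `I` for the convex
function `J ↦ Tr(J⁻¹)`. -/
theorem two_mul_trace_inv_le {ι : Type*} [Fintype ι] [DecidableEq ι] {I J : Matrix ι ι ℝ}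
    (hI : I.IsHermitian) (hJ : J.PosSemidef) (hJu : IsUnit J) :
    2 * (I⁻¹).trace ≤ (J⁻¹).trace + (I⁻¹ * J * I⁻¹).trace := by
  have h := (hJ.conjTranspose_mul_mul_same (I⁻¹ - J⁻¹)).trace_nonneg
  rw [(hI.inv.sub hJ.1.inv).eq] at h
  have hJ1 : J⁻¹ * J = 1 :=
    Matrix.nonsing_inv_mul J ((Matrix.isUnit_iff_isUnit_det J).1 hJu)
  have hJ2 : J * J⁻¹ = 1 :=
    Matrix.mul_nonsing_inv J ((Matrix.isUnit_iff_isUnit_det J).1 hJu)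
  have e : (I⁻¹ - J⁻¹) * J * (I⁻¹ - J⁻¹) = I⁻¹ * J * I⁻¹ - I⁻¹ - (I⁻¹ - J⁻¹) := by
    rw [Matrix.sub_mul, hJ1, Matrix.mul_sub, Matrix.sub_mul, Matrix.sub_mul, Matrix.one_mul,
      Matrix.one_mul, Matrix.mul_assoc _ J J⁻¹, hJ2, Matrix.mul_one]
  rw [e, Matrix.trace_sub, Matrix.trace_sub, Matrix.trace_sub] at h
  linarith

variable {m n : ℕ} {C : Matrix (Fin m) (Fin n) ℝ} {W : Set (EuclideanSpace ℝ (Fin m))}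
  {γ η : EuclideanSpace ℝ (Fin m) → ℝ}

theorem IsAdmissibleDensity.mem_interior (h : IsAdmissibleDensity W η)
    {w : EuclideanSpace ℝ (Fin m)} (hw : η w ≠ 0) : w ∈ interior W :=
  mem_interior_of_ne_zero h.eq_zero_of_notMem h.boundary hw

theorem IsAdmissibleDensity.contDiffAt (h : IsAdmissibleDensity W η)
    {w : EuclideanSpace ℝ (Fin m)} (hw : w ∈ interior W) : ContDiffAt ℝ 2 η w :=
  h.contDiffOn.contDiffAt (mem_interior_iff_mem_nhds.1 hw)

theorem IsAdmissibleDensity.differentiableAt (h : IsAdmissibleDensity W η)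
    {w : EuclideanSpace ℝ (Fin m)} (hw : η w ≠ 0) : DifferentiableAt ℝ η w :=
  (h.contDiffAt (h.mem_interior hw)).differentiableAt (by norm_num)

theorem IsAdmissibleDensity.continuous (h : IsAdmissibleDensity W η) : Continuous η :=
  continuous_of_continuousOn_closure h.continuousOn_closure h.eq_zero_of_notMem h.boundary

theorem IsAdmissibleDensity.integrable_univ (h : IsAdmissibleDensity W η) : Integrable η :=
  (integrableOn_iff_integrable_of_support_subset fun w hw =>
    by_contra fun h' => hw (h.eq_zero_of_notMem w h')).1 h.integrable

theorem IsAdmissibleDensity.integral_univ (h : IsAdmissibleDensity W η) : ∫ w, η w = 1 := by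
  rw [← setIntegral_eq_integral_of_forall_compl_eq_zero h.eq_zero_of_notMem]
  exact h.integral_eq_one

theorem IsAdmissibleDensity.fisherInformation_eq (h : IsAdmissibleDensity W η)
    (x : EuclideanSpace ℝ (Fin n)) :
    fisherInformation (linearQuery C) W η x = noiseFisher C η :=
  fisherInformation_linearQuery h.eq_zero_of_notMem (fun _ => h.differentiableAt) x

theorem IsAdmissibleDensity.hasRegularFisher_iff (h : IsAdmissibleDensity W η)
    (x : EuclideanSpace ℝ (Fin n)) :
    HasRegularFisher (linearQuery C) W η x ↔
      (∀ i j, Integrable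
        (fisherForm η (queryLin C (Pi.single i 1)) (queryLin C (Pi.single j 1)))) ∧
        IsUnit (noiseFisher C η) :=
  _root_.hasRegularFisher_iff h.eq_zero_of_notMem (fun _ => h.differentiableAt) x

/-- A kernel vector of `C` is also a kernel vector of the Fisher matrix. -/
theorem queryLin_injective (hi : ∀ i j, Integrable
      (fisherForm η (queryLin C (Pi.single i 1)) (queryLin C (Pi.single j 1))))
    (hu : IsUnit (noiseFisher C η)) : Function.Injective (queryLin C) := by
  rw [← LinearMap.ker_eq_bot, LinearMap.ker_eq_bot']
  intro z hz
  have h : ∀ z', dotProduct z' ((noiseFisher C η).mulVec z) = 0 := by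
    intro z'
    rw [← integral_fisherForm hi z' z, hz]
    simp [fisherForm]
  have h0 := dotProduct_eq_zero _ fun z' => (dotProduct_comm _ _).trans (h z')
  exact Matrix.mulVec_injective_of_isUnit hu (h0.trans (Matrix.mulVec_zero _).symm)

theorem privacyObjective_eq (h : IsAdmissibleDensity W η)
    (X : Set (EuclideanSpace ℝ (Fin n))) (p : EuclideanSpace ℝ (Fin n) → ℝ) :
    privacyObjective (linearQuery C) X p W η =
      ((noiseFisher C η)⁻¹).trace * ∫ x in X, p x := by
  simp only [privacyObjective, h.fisherInformation_eq]
  rw [integral_const_mul]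

/-- The image of a column of the inverse Fisher information. -/
noncomputable def optimalDirection (C : Matrix (Fin m) (Fin n) ℝ)
    (γ : EuclideanSpace ℝ (Fin m) → ℝ) (a : Fin n) : EuclideanSpace ℝ (Fin m) :=
  queryLin C fun i => (noiseFisher C γ)⁻¹ i a

theorem trace_inv_mul_noiseFisher_mul_inv (hγ : (noiseFisher C γ).IsHermitian)
    (hi : ∀ i j, Integrable
      (fisherForm η (queryLin C (Pi.single i 1)) (queryLin C (Pi.single j 1)))) :
    ((noiseFisher C γ)⁻¹ * noiseFisher C η * (noiseFisher C γ)⁻¹).trace =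
      ∑ a, ∫ w, fisherForm η (optimalDirection C γ a) (optimalDirection C γ a) w := by
  refine Finset.sum_congr rfl fun a _ => ?_
  rw [optimalDirection, integral_fisherForm hi, Matrix.diag_apply, Matrix.mul_assoc,
    Matrix.mul_apply]
  refine Finset.sum_congr rfl fun i _ => ?_
  rw [← hγ.inv.apply a i, star_trivial]
  rfl

/-- By convexity of the trace of the inverse, an optimal density minimises a linear functional
of the Fisher information. -/
theorem trace_inv_le_of_feasible {X : Set (EuclideanSpace ℝ (Fin n))}
    {p : EuclideanSpace ℝ (Fin n) → ℝ} (hpX : 0 < ∫ x in X, p x)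
    (hγ : IsOptimalDensity (linearQuery C) X p W γ)
    (hη : η ∈ feasibleDensities (linearQuery C) X W) :
    ((noiseFisher C γ)⁻¹).trace ≤
      ∑ a, ∫ w, fisherForm η (optimalDirection C γ a) (optimalDirection C γ a) w := by
  obtain ⟨x, hx⟩ := nonempty_of_setIntegral_pos hpX
  have h1 := (hγ.1.1.hasRegularFisher_iff x).1 (hγ.1.2 x hx)
  have h2 := (hη.1.hasRegularFisher_iff x).1 (hη.2 x hx)
  have hmax : privacyObjective (linearQuery C) X p W η ≤
    privacyObjective (linearQuery C) X p W γ := hγ.2 hη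
  rw [privacyObjective_eq hη.1, privacyObjective_eq hγ.1.1] at hmax
  have hle := le_of_mul_le_mul_right hmax hpX
  have hpsd := posSemidef_noiseFisher hγ.1.1.nonneg h1.1
  -- Maximality gives `Tr(J⁻¹) ≤ Tr(I⁻¹)`, which absorbs one of the two copies of `Tr(I⁻¹)`.
  have hconv := two_mul_trace_inv_le hpsd.1 (posSemidef_noiseFisher hη.1.nonneg h2.1) h2.2
  rw [trace_inv_mul_noiseFisher_mul_inv hpsd.1 h2.1] at hconv
  linarith

theorem fisherForm_sq_div {E : Type*} [NormedAddCommGroup E] [NormedSpace ℝ E] {s : E → ℝ}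
    {w : E} (hd : s w ≠ 0 → DifferentiableAt ℝ s w) (Z : ℝ) (a b : E) :
    fisherForm (fun w => s w ^ 2 / Z) a b w =
      if s w = 0 then 0 else 4 / Z * (fderiv ℝ s w a * fderiv ℝ s w b) := by
  split_ifs with h
  · simp [fisherForm, h]
  · by_cases hZ : Z = 0
    · simp [fisherForm, hZ]
    have h1 := ((hd h).hasFDerivAt.pow 2).mul_const Z⁻¹
    have h2 : fderiv ℝ (fun w => s w ^ 2 / Z) w = Z⁻¹ • ((2 * s w) • fderiv ℝ s w) := by
      simp only [div_eq_mul_inv]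
      rw [h1.fderiv]
      simp
    simp only [fisherForm, h2]
    simp
    field_simp
    ring

/-- The square root of an optimal density minimises a Dirichlet energy under an `L²` constraint. -/
theorem trace_inv_mul_integral_sq_le {X : Set (EuclideanSpace ℝ (Fin n))}
    {p : EuclideanSpace ℝ (Fin n) → ℝ} (hpX : 0 < ∫ x in X, p x)
    (hγ : IsOptimalDensity (linearQuery C) X p W γ) {s : EuclideanSpace ℝ (Fin m) → ℝ}
    (h0 : ∀ w, w ∉ W → s w = 0) (hb : ∀ w ∈ frontier W, s w = 0) (hcd : ContDiffOn ℝ 2 s W)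
    (hc : Continuous s) (hi : Integrable fun w => s w ^ 2)
    (hi' : ∀ z, Integrable fun w => (fderiv ℝ s w (queryLin C z)) ^ 2) :
    ((noiseFisher C γ)⁻¹).trace * ∫ w, s w ^ 2 ≤
      4 * ∑ a, ∫ w, (fderiv ℝ s w (optimalDirection C γ a)) ^ 2 := by
  obtain ⟨x, hx⟩ := nonempty_of_setIntegral_pos hpX
  set Z := ∫ w, s w ^ 2 with hZ
  have hZ0 : 0 ≤ Z := integral_nonneg fun w => sq_nonneg _
  rcases hZ0.eq_or_lt with hZ0 | hZpos
  · rw [← hZ0, mul_zero]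
    exact mul_nonneg (by norm_num) (Finset.sum_nonneg fun a _ => integral_nonneg fun w => sq_nonneg _)
  have hsat : ∀ w, s w ≠ 0 → ContDiffAt ℝ 2 s w := fun w hw =>
    hcd.contDiffAt (mem_interior_iff_mem_nhds.1 (mem_interior_of_ne_zero h0 hb hw))
  have hsd : ∀ w, s w ≠ 0 → DifferentiableAt ℝ s w := fun w hw =>
    (hsat w hw).differentiableAt (by norm_num)
  have hη : IsAdmissibleDensity W fun w => s w ^ 2 / Z := by
    have hint : ∫ w, s w ^ 2 / Z = 1 := by
      rw [integral_div, ← hZ, div_self hZpos.ne']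
    refine ⟨fun w => by positivity, fun w hw => by simp [h0 w hw], (hi.div_const Z).integrableOn,
      ?_, (hcd.pow 2).div_const Z, ?_, fun w hw => by simp [hb w hw]⟩
    · rw [setIntegral_eq_integral_of_forall_compl_eq_zero fun w hw => by simp [h0 w hw], hint]
    · exact (by fun_prop : Continuous fun w => s w ^ 2 / Z).continuousOn
  have hform := fun w => fisherForm_sq_div (w := w) (hsd w) Z
  have hset : MeasurableSet {w | s w = 0} := hc.measurable (measurableSet_singleton 0)
  have hfi : ∀ z z', Integrable (fisherForm (fun w => s w ^ 2 / Z) (queryLin C z) (queryLin C z')) := by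
    intro z z'
    refine Integrable.mono' (g := fun w => 4 / Z * ((fderiv ℝ s w (queryLin C z)) ^ 2 +
      (fderiv ℝ s w (queryLin C z')) ^ 2)) (((hi' z).add (hi' z')).const_mul _) ?_ ?_
    · rw [funext fun w => hform w (queryLin C z) (queryLin C z')]
      exact (Measurable.ite hset measurable_const (((measurable_fderiv_apply_const ℝ s _).mul
        (measurable_fderiv_apply_const ℝ s _)).const_mul _)).aestronglyMeasurable
    · refine Filter.Eventually.of_forall fun w => ?_
      rw [hform]
      split_ifs
      · rw [norm_zero]; positivity
      · rw [norm_mul, Real.norm_of_nonneg (by positivity : 0 ≤ 4 / Z), norm_mul]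
        refine mul_le_mul_of_nonneg_left ?_ (by positivity)
        simp only [Real.norm_eq_abs]
        nlinarith [sq_abs (fderiv ℝ s w (queryLin C z)), sq_abs (fderiv ℝ s w (queryLin C z')),
          sq_nonneg (|fderiv ℝ s w (queryLin C z)| - |fderiv ℝ s w (queryLin C z')|),
          sq_nonneg (fderiv ℝ s w (queryLin C z)), sq_nonneg (fderiv ℝ s w (queryLin C z'))]
  have hreg := (hγ.1.1.hasRegularFisher_iff x).1 (hγ.1.2 x hx)
  have hfeas : (fun w => s w ^ 2 / Z) ∈ feasibleDensities (linearQuery C) X W := by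
    refine ⟨hη, fun x' _ => (hη.hasRegularFisher_iff x').2 ⟨fun i j => hfi _ _, ?_⟩⟩
    refine isUnit_noiseFisher (queryLin_injective hreg.1 hreg.2) hη.nonneg hη.continuous
      hη.integrable_univ (by rw [hη.integral_univ]; exact one_ne_zero) (fun w hw => ?_)
      fun i j => hfi _ _
    exact (hη.contDiffAt (hη.mem_interior hw)).of_le (by norm_num)
  have hmain := trace_inv_le_of_feasible hpX hγ hfeas
  -- Only an inequality: where `s = 0` the Fisher form is `0` by convention, while the derivative of
  -- `s`, which may change sign, need not vanish.
  have hle : ∀ a, ∫ w, fisherForm (fun w => s w ^ 2 / Z) (optimalDirection C γ a)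
      (optimalDirection C γ a) w ≤
      4 / Z * ∫ w, (fderiv ℝ s w (optimalDirection C γ a)) ^ 2 := by
    intro a
    rw [← integral_const_mul]
    refine integral_mono (hfi _ _) ((hi' _).const_mul _) fun w => ?_
    simp only [hform]
    split_ifs
    · positivity
    · rw [sq]
  have h2 := hmain.trans (Finset.sum_le_sum fun a _ => hle a)
  rw [← Finset.mul_sum, div_mul_eq_mul_div, le_div_iff₀ hZpos] at h2
  exact h2
end

/-! ### First variation and the weak Euler–Lagrange equation -/

section
-- For small `t` of either sign the linear term dominates. With `K = |c| + 1`, the choice `t = b /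
-- (2K)` gives `b² / (2K) ≤ b² / (4K)`.
theorem eq_zero_of_forall_mul_le_sq_mul {b c : ℝ} (h : ∀ t : ℝ, t * b ≤ t ^ 2 * c) : b = 0 := by
  have hc : 0 < |c| + 1 := by positivity
  have h1 := h (b / (2 * (|c| + 1)))
  have h2 : (b / (2 * (|c| + 1))) ^ 2 * c ≤ (b / (2 * (|c| + 1))) ^ 2 * (|c| + 1) :=
    mul_le_mul_of_nonneg_left (by linarith [le_abs_self c]) (sq_nonneg _)
  have h3 := h1.trans h2
  rw [div_pow, div_mul_eq_mul_div, div_mul_eq_mul_div, div_le_div_iff₀ (by positivity)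
    (by positivity)] at h3
  have h4 : b ^ 2 * (2 * (|c| + 1) ^ 2) ≤ 0 := by nlinarith
  have h5 : b ^ 2 ≤ 0 := by
    by_contra hb
    exact absurd h4 (not_le.2 (mul_pos (not_le.1 hb) (by positivity)))
  exact pow_eq_zero_iff two_ne_zero |>.1 (le_antisymm h5 (sq_nonneg b))

/-- A twice differentiable approximation of the square root. -/
noncomputable def smoothSqrt (ε x : ℝ) : ℝ := Real.sqrt (x + ε ^ 2) - ε

/-- The shift by `-ε` preserves the zeros of `γ`, hence the boundary condition of the competitor. -/
theorem smoothSqrt_zero {ε : ℝ} (hε : 0 ≤ ε) : smoothSqrt ε 0 = 0 := by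
  simp [smoothSqrt, Real.sqrt_sq hε]

theorem smoothSqrt_nonneg {ε x : ℝ} (hx : 0 ≤ x) : 0 ≤ smoothSqrt ε x :=
  sub_nonneg.2 (Real.le_sqrt_of_sq_le (by linarith))

theorem smoothSqrt_le {ε x : ℝ} (hε : 0 ≤ ε) (hx : 0 ≤ x) : smoothSqrt ε x ≤ Real.sqrt x := by
  rw [smoothSqrt, sub_le_iff_le_add, Real.sqrt_le_left (by positivity)]
  nlinarith [Real.sq_sqrt hx, Real.sqrt_nonneg x]

theorem tendsto_smoothSqrt (x : ℝ) :
    Filter.Tendsto (fun ε => smoothSqrt ε x) (nhdsWithin 0 (Set.Ioi 0)) (nhds (Real.sqrt x)) := by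
  have : Continuous fun ε => smoothSqrt ε x := by unfold smoothSqrt; fun_prop
  simpa [smoothSqrt] using (this.tendsto 0).mono_left (nhdsWithin_le_nhds (s := Set.Ioi 0))

theorem contDiffOn_smoothSqrt_comp {E : Type*} [NormedAddCommGroup E] [NormedSpace ℝ E]
    {g : E → ℝ} {W : Set E} {k : WithTop ℕ∞} (hg : ContDiffOn ℝ k g W) (h0 : ∀ w, 0 ≤ g w) {ε : ℝ}
    (hε : 0 < ε) : ContDiffOn ℝ k (fun w => smoothSqrt ε (g w)) W :=
  ((hg.add contDiffOn_const).sqrt fun w _ => by have := h0 w; positivity).sub contDiffOn_const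

/-- Where `g > 0` the left side is `(∂g)² / (4(g + ε²))`; at a zero of `g` the derivative vanishes
by minimality. Regularisation thus never increases the energy. -/
theorem sq_fderiv_smoothSqrt_le {E : Type*} [NormedAddCommGroup E] [NormedSpace ℝ E]
    {g : E → ℝ} (h0 : ∀ w, 0 ≤ g w) (hd : ∀ w, g w ≠ 0 → DifferentiableAt ℝ g w) {ε : ℝ}
    (hε : 0 < ε) (w e : E) :
    (fderiv ℝ (fun w => smoothSqrt ε (g w)) w e) ^ 2 ≤ fisherForm g e e w / 4 := by
  by_cases hw : g w = 0
  · rw [fderiv_eq_zero_of_nonneg (fun w => smoothSqrt_nonneg (h0 w))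
      (by rw [hw, smoothSqrt_zero hε.le])]
    simp [fisherForm, hw]
  · have hpos : 0 < g w := lt_of_le_of_ne (h0 w) (Ne.symm hw)
    have h1 := (((hd w hw).hasFDerivAt.add_const (ε ^ 2)).sqrt (by positivity)).sub_const ε
    have h2 : fderiv ℝ (fun w => smoothSqrt ε (g w)) w = _ := h1.fderiv
    rw [h2]
    simp only [_root_.smul_apply, smul_eq_mul, mul_pow, div_pow,
      Real.sq_sqrt (by positivity : 0 ≤ g w + ε ^ 2), fisherForm, one_pow]
    rw [← sq, div_mul_eq_mul_div, one_mul, div_div, mul_comm (g w) 4]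
    exact div_le_div_of_nonneg_left (sq_nonneg _) (by positivity)
      (by nlinarith [sq_nonneg ε])

theorem integrable_sq_of_hasCompactSupport {E : Type*} [NormedAddCommGroup E] [MeasurableSpace E]
    [BorelSpace E] {μ : Measure E} [IsFiniteMeasureOnCompacts μ] {f : E → ℝ}
    (hf : Continuous f) (hc : HasCompactSupport f) : Integrable (fun w => f w ^ 2) μ := by
  simp only [sq]
  exact (hf.mul hf).integrable_of_hasCompactSupport hc.mul_left

section
variable {E : Type*} [NormedAddCommGroup E] [NormedSpace ℝ E]

/-- Off the support of `φ` the sum is locally `g`, so the formula survives even where `g` is not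
differentiable. -/
theorem fderiv_add_mul_of_tsupport_subset {W : Set E} {g φ : E → ℝ}
    (hg : ∀ w ∈ interior W, DifferentiableAt ℝ g w) (hφ : Differentiable ℝ φ)
    (hs : tsupport φ ⊆ interior W) (t : ℝ) (w : E) :
    fderiv ℝ (fun w => g w + t * φ w) w = fderiv ℝ g w + t • fderiv ℝ φ w := by
  by_cases hw : w ∈ tsupport φ
  · exact ((hg w (hs hw)).hasFDerivAt.add ((hφ w).hasFDerivAt.const_mul t)).fderiv
  · have h0 : φ =ᶠ[nhds w] 0 := notMem_tsupport_iff_eventuallyEq.1 hw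
    have h1 : (fun w => g w + t * φ w) =ᶠ[nhds w] g := by
      filter_upwards [h0] with y hy
      simp [hy]
    rw [h1.fderiv_eq, h0.fderiv_eq]
    simp

theorem continuous_fderiv_fderiv_apply {φ : E → ℝ} (hφ : ContDiff ℝ 2 φ) (e e' : E) :
    Continuous fun w => fderiv ℝ (fun y => fderiv ℝ φ y e) w e' :=
  ((hφ.fderiv_right (m := 1) (by norm_num)).clm_apply contDiff_const).continuous_fderiv
    (by norm_num) |>.clm_apply continuous_const

theorem hasCompactSupport_fderiv_fderiv_apply {φ : E → ℝ} (hc : HasCompactSupport φ) (e e' : E) :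
    HasCompactSupport fun w => fderiv ℝ (fun y => fderiv ℝ φ y e) w e' :=
  (hc.fderiv_apply ℝ e).fderiv_apply ℝ e'

theorem continuous_sumSecondDeriv {ι : Type*} [Fintype ι] {φ : E → ℝ} (hφ : ContDiff ℝ 2 φ)
    (v : ι → E) : Continuous (sumSecondDeriv v φ) :=
  continuous_finsetSum _ fun a _ => continuous_fderiv_fderiv_apply hφ (v a) (v a)

variable [FiniteDimensional ℝ E] [MeasurableSpace E] [BorelSpace E] {μ : Measure E}
  [μ.IsAddHaarMeasure]

/-- Integration by parts against a compactly supported function, when `g` is differentiable on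
its support only. -/
theorem integral_fderiv_mul_fderiv_eq {g φ : E → ℝ} {Ω : Set E}
    (hg : ∀ w ∈ Ω, DifferentiableAt ℝ g w) (hgc : Continuous g) (hφ : ContDiff ℝ 2 φ)
    (hc : HasCompactSupport φ) (hs : tsupport φ ⊆ Ω) {e : E}
    (hi : Integrable (fun w => fderiv ℝ g w e * fderiv ℝ φ w e) μ) :
    ∫ w, fderiv ℝ g w e * fderiv ℝ φ w e ∂μ =
      -∫ w, g w * fderiv ℝ (fun y => fderiv ℝ φ y e) w e ∂μ := by
  have h1 : ContDiff ℝ 1 fun y => fderiv ℝ φ y e :=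
    (hφ.fderiv_right (m := 1) (by norm_num)).clm_apply contDiff_const
  have hc1 : HasCompactSupport fun y => fderiv ℝ φ y e := hc.fderiv_apply ℝ e
  rw [integral_mul_fderiv_eq_neg_fderiv_mul_of_integrable hi, neg_neg]
  · exact (hgc.mul (continuous_fderiv_fderiv_apply hφ e e)).integrable_of_hasCompactSupport
      (hasCompactSupport_fderiv_fderiv_apply hc e e).mul_left
  · exact (hgc.mul h1.continuous).integrable_of_hasCompactSupport hc1.mul_left
  · exact fun x hx => hg x (hs (tsupport_fderiv_apply_subset ℝ e hx))
  · exact fun x _ => (h1.differentiable (by norm_num)) x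
end

variable {m n : ℕ} {C : Matrix (Fin m) (Fin n) ℝ} {W : Set (EuclideanSpace ℝ (Fin m))}
  {γ : EuclideanSpace ℝ (Fin m) → ℝ} {X : Set (EuclideanSpace ℝ (Fin n))}
  {p : EuclideanSpace ℝ (Fin n) → ℝ}

theorem sum_integral_fisherForm_optimalDirection (h0 : ∀ w, 0 ≤ γ w) (hi : ∀ i j, Integrable
      (fisherForm γ (queryLin C (Pi.single i 1)) (queryLin C (Pi.single j 1))))
    (hu : IsUnit (noiseFisher C γ)) :
    ∑ a, ∫ w, fisherForm γ (optimalDirection C γ a) (optimalDirection C γ a) w =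
      ((noiseFisher C γ)⁻¹).trace := by
  rw [← trace_inv_mul_noiseFisher_mul_inv (posSemidef_noiseFisher h0 hi).1 hi,
    Matrix.nonsing_inv_mul _ ((Matrix.isUnit_iff_isUnit_det _).1 hu), Matrix.one_mul]

-- Minimality is tested on `smoothSqrt ε γ + t φ`: the pure energy is bounded by that of `γ`, namely
-- `Tr(I⁻¹)`, and the cross term is integrated by parts onto `φ`.
set_option maxHeartbeats 800000 in
theorem trace_inv_mul_integral_smoothSqrt_le (hpX : 0 < ∫ x in X, p x)
    (hγ : IsOptimalDensity (linearQuery C) X p W γ) {φ : EuclideanSpace ℝ (Fin m) → ℝ}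
    (hφ : ContDiff ℝ 2 φ) (hc : HasCompactSupport φ) (hs : tsupport φ ⊆ interior W) (t : ℝ)
    {ε : ℝ} (hε : 0 < ε) :
    ((noiseFisher C γ)⁻¹).trace * ∫ w, (smoothSqrt ε (γ w) + t * φ w) ^ 2 ≤
      ((noiseFisher C γ)⁻¹).trace -
        8 * t * (∫ w, smoothSqrt ε (γ w) * sumSecondDeriv (optimalDirection C γ) φ w) +
        4 * t ^ 2 * ∑ a, ∫ w, (fderiv ℝ φ w (optimalDirection C γ a)) ^ 2 := by
  obtain ⟨x, hx⟩ := nonempty_of_setIntegral_pos hpX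
  have hreg := (hγ.1.1.hasRegularFisher_iff x).1 (hγ.1.2 x hx)
  have hA := hγ.1.1
  set g := fun w => smoothSqrt ε (γ w) with hg
  have hgcd : ContDiffOn ℝ 2 g W := contDiffOn_smoothSqrt_comp hA.contDiffOn hA.nonneg hε
  have hgd : ∀ w ∈ interior W, DifferentiableAt ℝ g w := fun w hw =>
    (hgcd.contDiffAt (mem_interior_iff_mem_nhds.1 hw)).differentiableAt (by norm_num)
  have hgc : Continuous g := by
    have := hA.continuous
    simp only [hg, smoothSqrt]
    fun_prop
  have hg0 : ∀ w, γ w = 0 → g w = 0 := fun w hw => by simp only [hg, hw, smoothSqrt_zero hε.le]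
  have hφ0 : ∀ w, w ∉ interior W → φ w = 0 := fun w hw =>
    image_eq_zero_of_notMem_tsupport fun h => hw (hs h)
  have hφd : Differentiable ℝ φ := hφ.differentiable (by norm_num)
  have hφi : Integrable fun w => φ w ^ 2 :=
    integrable_sq_of_hasCompactSupport hφ.continuous hc
  have hDφ : ∀ e, Integrable fun w => (fderiv ℝ φ w e) ^ 2 := fun e =>
    integrable_sq_of_hasCompactSupport
      ((hφ.continuous_fderiv (by norm_num)).clm_apply continuous_const) (hc.fderiv_apply ℝ e)
  have hgi : Integrable fun w => g w ^ 2 := by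
    refine hA.integrable_univ.mono' (hgc.pow 2).aestronglyMeasurable
      (Filter.Eventually.of_forall fun w => ?_)
    rw [Real.norm_of_nonneg (sq_nonneg _), ← Real.sq_sqrt (hA.nonneg w)]
    exact pow_le_pow_left₀ (smoothSqrt_nonneg (hA.nonneg w)) (smoothSqrt_le hε.le (hA.nonneg w)) 2
  have hDgle := sq_fderiv_smoothSqrt_le hA.nonneg (fun w => hA.differentiableAt) hε
  have hDg : ∀ z, Integrable fun w => (fderiv ℝ g w (queryLin C z)) ^ 2 := fun z => by
    refine ((integrable_fisherForm hreg.1 z z).div_const 4).mono'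
      ((measurable_fderiv_apply_const ℝ g _).pow_const 2).aestronglyMeasurable
      (Filter.Eventually.of_forall fun w => ?_)
    rw [Real.norm_of_nonneg (sq_nonneg _)]
    exact hDgle w _
  have hmul : ∀ {f h : EuclideanSpace ℝ (Fin m) → ℝ}, Measurable f → Measurable h →
      Integrable (fun w => f w ^ 2) → Integrable (fun w => h w ^ 2) →
      Integrable fun w => f w * h w := fun hf hh hf2 hh2 =>
    ((memLp_two_iff_integrable_sq hf.aestronglyMeasurable).2 hf2).integrable_mul
      ((memLp_two_iff_integrable_sq hh.aestronglyMeasurable).2 hh2)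
  have hcross : ∀ z, Integrable fun w => fderiv ℝ g w (queryLin C z) * fderiv ℝ φ w (queryLin C z) :=
    fun z => hmul (measurable_fderiv_apply_const ℝ g _) (measurable_fderiv_apply_const ℝ φ _)
      (hDg z) (hDφ _)
  have hexp : ∀ z w, (fderiv ℝ (fun w => g w + t * φ w) w (queryLin C z)) ^ 2 =
      (fderiv ℝ g w (queryLin C z)) ^ 2 +
        (2 * t * (fderiv ℝ g w (queryLin C z) * fderiv ℝ φ w (queryLin C z)) +
        t ^ 2 * (fderiv ℝ φ w (queryLin C z)) ^ 2) := fun z w => by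
    rw [fderiv_add_mul_of_tsupport_subset hgd hφd hs]
    simp
    ring
  have hexpi : ∀ z, ∫ w, (fderiv ℝ (fun w => g w + t * φ w) w (queryLin C z)) ^ 2 =
      (∫ w, (fderiv ℝ g w (queryLin C z)) ^ 2) -
        2 * t * (∫ w, g w * fderiv ℝ (fun y => fderiv ℝ φ y (queryLin C z)) w (queryLin C z)) +
        t ^ 2 * ∫ w, (fderiv ℝ φ w (queryLin C z)) ^ 2 := fun z => by
    have h1 : Integrable fun w => 2 * t * (fderiv ℝ g w (queryLin C z) *
        fderiv ℝ φ w (queryLin C z)) := (hcross z).const_mul _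
    have h2 : Integrable fun w => t ^ 2 * (fderiv ℝ φ w (queryLin C z)) ^ 2 :=
      (hDφ _).const_mul _
    have h3 : Integrable fun w => 2 * t * (fderiv ℝ g w (queryLin C z) *
        fderiv ℝ φ w (queryLin C z)) + t ^ 2 * (fderiv ℝ φ w (queryLin C z)) ^ 2 := h1.add h2
    simp only [hexp]
    rw [integral_add (hDg z) h3, integral_add h1 h2, integral_const_mul, integral_const_mul,
      integral_fderiv_mul_fderiv_eq hgd hgc hφ hc hs (hcross z)]
    ring
  have hmain := trace_inv_mul_integral_sq_le hpX hγ (s := fun w => g w + t * φ w)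
    (fun w hw => by
      simp only [hg0 w (hA.eq_zero_of_notMem w hw), hφ0 w fun h => hw (interior_subset h)]; simp)
    (fun w hw => by simp only [hg0 w (hA.boundary w hw), hφ0 w hw.2]; simp)
    (hgcd.add (contDiffOn_const.mul hφ.contDiffOn))
    (hgc.add (continuous_const.mul hφ.continuous)) ?_ ?_
  · refine hmain.trans ?_
    have hle : ∀ a, 4 * ∫ w, (fderiv ℝ (fun w => g w + t * φ w) w (optimalDirection C γ a)) ^ 2 ≤
        (∫ w, fisherForm γ (optimalDirection C γ a) (optimalDirection C γ a) w) -
        8 * t * (∫ w, g w * fderiv ℝ (fun y => fderiv ℝ φ y (optimalDirection C γ a)) w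
          (optimalDirection C γ a)) +
        4 * t ^ 2 * ∫ w, (fderiv ℝ φ w (optimalDirection C γ a)) ^ 2 := by
      intro a
      have h1 : ∫ w, (fderiv ℝ g w (optimalDirection C γ a)) ^ 2 ≤
          (∫ w, fisherForm γ (optimalDirection C γ a) (optimalDirection C γ a) w) / 4 := by
        rw [← integral_div]
        exact integral_mono (hDg _) ((integrable_fisherForm hreg.1 _ _).div_const 4)
          fun w => hDgle w _
      have h2 := hexpi fun i => (noiseFisher C γ)⁻¹ i a
      change ∫ w, (fderiv ℝ (fun w => g w + t * φ w) w (optimalDirection C γ a)) ^ 2 = _ at h2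
      rw [h2]
      change 4 * ((∫ w, (fderiv ℝ g w (optimalDirection C γ a)) ^ 2) - 2 * t * (∫ w, g w *
        fderiv ℝ (fun y => fderiv ℝ φ y (optimalDirection C γ a)) w (optimalDirection C γ a)) +
        t ^ 2 * ∫ w, (fderiv ℝ φ w (optimalDirection C γ a)) ^ 2) ≤ _
      linarith
    rw [Finset.mul_sum]
    refine (Finset.sum_le_sum fun a _ => hle a).trans (le_of_eq ?_)
    rw [Finset.sum_add_distrib, Finset.sum_sub_distrib,
      sum_integral_fisherForm_optimalDirection hA.nonneg hreg.1 hreg.2, ← Finset.mul_sum,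
      ← Finset.mul_sum, ← integral_finsetSum]
    · simp only [sumSecondDeriv, Finset.mul_sum, hg]
    · intro a _
      exact (hgc.mul (continuous_fderiv_fderiv_apply hφ _ _)).integrable_of_hasCompactSupport
        (hasCompactSupport_fderiv_fderiv_apply hc _ _).mul_left
  · have h1 := hmul hgc.measurable hφ.continuous.measurable hgi hφi
    refine ((hgi.add (h1.const_mul (2 * t))).add (hφi.const_mul (t ^ 2))).congr
      (Filter.Eventually.of_forall fun w => ?_)
    simp only [Pi.add_apply]
    ring
  · intro z
    simp only [hexp]
    exact (hDg z).add (((hcross z).const_mul _).add ((hDφ _).const_mul _))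

set_option maxHeartbeats 800000 in
/-- The Euler-Lagrange equation of the square root of an optimal density, in weak form. -/
theorem integral_sqrt_mul_sumSecondDeriv (hpX : 0 < ∫ x in X, p x)
    (hγ : IsOptimalDensity (linearQuery C) X p W γ) {φ : EuclideanSpace ℝ (Fin m) → ℝ}
    (hφ : ContDiff ℝ 2 φ) (hc : HasCompactSupport φ) (hs : tsupport φ ⊆ interior W) :
    ∫ w, Real.sqrt (γ w) * sumSecondDeriv (optimalDirection C γ) φ w =
      -(((noiseFisher C γ)⁻¹).trace / 4 * ∫ w, Real.sqrt (γ w) * φ w) := by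
  have hA := hγ.1.1
  have hγc := hA.continuous
  have hLc := continuous_sumSecondDeriv hφ (optimalDirection C γ)
  have hLs : HasCompactSupport (sumSecondDeriv (optimalDirection C γ) φ) := by
    refine HasCompactSupport.of_support_subset_isCompact hc fun w hw => ?_
    by_contra h
    refine hw (Finset.sum_eq_zero fun a _ => ?_)
    have h1 : w ∉ tsupport fun y => fderiv ℝ φ y (optimalDirection C γ a) :=
      fun h' => h (tsupport_fderiv_apply_subset ℝ _ h')
    exact image_eq_zero_of_notMem_tsupport
      (f := fun w => fderiv ℝ (fun y => fderiv ℝ φ y (optimalDirection C γ a)) w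
        (optimalDirection C γ a)) fun h' => h1 (tsupport_fderiv_apply_subset ℝ _ h')
  have hφi : Integrable fun w => φ w ^ 2 :=
    integrable_sq_of_hasCompactSupport hφ.continuous hc
  have huφ : Integrable fun w => Real.sqrt (γ w) * φ w :=
    (hγc.sqrt.mul hφ.continuous).integrable_of_hasCompactSupport hc.mul_left
  have hev : ∀ᶠ ε : ℝ in nhdsWithin 0 (Set.Ioi 0), 0 < ε := self_mem_nhdsWithin
  have hlim1 : ∀ t : ℝ, Filter.Tendsto (fun ε => ∫ w, (smoothSqrt ε (γ w) + t * φ w) ^ 2)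
      (nhdsWithin 0 (Set.Ioi 0)) (nhds (∫ w, (Real.sqrt (γ w) + t * φ w) ^ 2)) := by
    intro t
    refine tendsto_integral_filter_of_dominated_convergence
      (fun w => 2 * γ w + 2 * (t ^ 2 * φ w ^ 2)) ?_ ?_
      ((hA.integrable_univ.const_mul 2).add ((hφi.const_mul (t ^ 2)).const_mul 2)) ?_
    · refine Filter.Eventually.of_forall fun ε => Continuous.aestronglyMeasurable ?_
      have := hφ.continuous
      unfold smoothSqrt
      fun_prop
    · filter_upwards [hev] with ε hε
      refine Filter.Eventually.of_forall fun w => ?_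
      rw [Real.norm_of_nonneg (sq_nonneg _)]
      have h1 : smoothSqrt ε (γ w) ^ 2 ≤ γ w := by
        have := pow_le_pow_left₀ (smoothSqrt_nonneg (hA.nonneg w))
          (smoothSqrt_le hε.le (hA.nonneg w)) 2
        rwa [Real.sq_sqrt (hA.nonneg w)] at this
      nlinarith [sq_nonneg (smoothSqrt ε (γ w) - t * φ w)]
    · exact Filter.Eventually.of_forall fun w => ((tendsto_smoothSqrt (γ w)).add_const _).pow 2
  have hlim2 : Filter.Tendsto
      (fun ε => ∫ w, smoothSqrt ε (γ w) * sumSecondDeriv (optimalDirection C γ) φ w)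
      (nhdsWithin 0 (Set.Ioi 0))
      (nhds (∫ w, Real.sqrt (γ w) * sumSecondDeriv (optimalDirection C γ) φ w)) := by
    refine tendsto_integral_filter_of_dominated_convergence
      (fun w => Real.sqrt (γ w) * |sumSecondDeriv (optimalDirection C γ) φ w|) ?_ ?_
      ((hγc.sqrt.mul hLc.abs).integrable_of_hasCompactSupport
        (hLs.comp_left (g := fun x => |x|) abs_zero).mul_left) ?_
    · refine Filter.Eventually.of_forall fun ε => Continuous.aestronglyMeasurable ?_
      unfold smoothSqrt
      fun_prop
    · filter_upwards [hev] with ε hε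
      refine Filter.Eventually.of_forall fun w => ?_
      rw [norm_mul, Real.norm_of_nonneg (smoothSqrt_nonneg (hA.nonneg w)), Real.norm_eq_abs]
      exact mul_le_mul_of_nonneg_right (smoothSqrt_le hε.le (hA.nonneg w)) (abs_nonneg _)
    · exact Filter.Eventually.of_forall fun w => (tendsto_smoothSqrt (γ w)).mul_const _
  -- The limit `ε → 0` is taken at fixed `t`; after the integration by parts no derivative of the
  -- regularised root is left.
  have hineq : ∀ t : ℝ, ((noiseFisher C γ)⁻¹).trace * ∫ w, (Real.sqrt (γ w) + t * φ w) ^ 2 ≤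
      ((noiseFisher C γ)⁻¹).trace -
        8 * t * (∫ w, Real.sqrt (γ w) * sumSecondDeriv (optimalDirection C γ) φ w) +
        4 * t ^ 2 * ∑ a, ∫ w, (fderiv ℝ φ w (optimalDirection C γ a)) ^ 2 := fun t =>
    le_of_tendsto_of_tendsto ((hlim1 t).const_mul _)
      (((hlim2.const_mul (8 * t)).const_sub _).add_const _)
      (hev.mono fun ε hε => trace_inv_mul_integral_smoothSqrt_le hpX hγ hφ hc hs t hε)
  have hexp : ∀ t : ℝ, ∫ w, (Real.sqrt (γ w) + t * φ w) ^ 2 =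
      1 + 2 * t * (∫ w, Real.sqrt (γ w) * φ w) + t ^ 2 * ∫ w, φ w ^ 2 := by
    intro t
    have h1 : Integrable fun w => 2 * t * (Real.sqrt (γ w) * φ w) := huφ.const_mul _
    have h2 : Integrable fun w => t ^ 2 * φ w ^ 2 := hφi.const_mul _
    have h3 : Integrable fun w => γ w + 2 * t * (Real.sqrt (γ w) * φ w) :=
      hA.integrable_univ.add h1
    have h4 : ∀ w, (Real.sqrt (γ w) + t * φ w) ^ 2 =
        γ w + 2 * t * (Real.sqrt (γ w) * φ w) + t ^ 2 * φ w ^ 2 := fun w => by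
      rw [add_sq, Real.sq_sqrt (hA.nonneg w)]
      ring
    simp only [h4]
    rw [integral_add h3 h2, integral_add hA.integrable_univ h1, hA.integral_univ,
      integral_const_mul, integral_const_mul]
  simp only [hexp] at hineq
  generalize ∫ w, Real.sqrt (γ w) * sumSecondDeriv (optimalDirection C γ) φ w = a at hineq ⊢
  generalize ∫ w, Real.sqrt (γ w) * φ w = b at hineq ⊢
  generalize ∫ w, φ w ^ 2 = c at hineq
  generalize ∑ a, ∫ w, (fderiv ℝ φ w (optimalDirection C γ a)) ^ 2 = d at hineq
  generalize ((noiseFisher C γ)⁻¹).trace = l at hineq ⊢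
  -- Since `∫ γ = 1`, the terms constant in `t` cancel, leaving `t (8a + 2lb) ≤ t² (4d - lc)` for
  -- every real `t`.
  have := eq_zero_of_forall_mul_le_sq_mul (b := 8 * a + 2 * (l * b)) (c := 4 * d - l * c)
    fun t => by linarith [hineq t]
  linarith
end

/-! ### Ellipticity and connectedness -/

theorem isUnit_of_rank_eq {ι : Type*} [Fintype ι] [DecidableEq ι] {A : Matrix ι ι ℝ}
    (h : A.rank = Fintype.card ι) : IsUnit A := by
  rw [← Matrix.mulVec_surjective_iff_isUnit]
  have : LinearMap.range A.mulVecLin = ⊤ :=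
    Submodule.eq_top_of_finrank_eq (by rw [Module.finrank_fintype_fun_eq_card]; exact h)
  exact LinearMap.range_eq_top.1 this

/-- The bilinear form inverse to `∑ a, v_a v_aᵀ`, for a spanning family `v`. -/
theorem exists_dual_form {m n : ℕ} (v : Fin n → EuclideanSpace ℝ (Fin m))
    (V : Matrix (Fin m) (Fin n) ℝ) (hV : ∀ a k, V k a = v a k) (hrank : V.rank = m) :
    ∃ (B : EuclideanSpace ℝ (Fin m) →L[ℝ] EuclideanSpace ℝ (Fin m) →L[ℝ] ℝ) (c : ℝ), 0 < c ∧
      (∀ x y, B x y = B y x) ∧ (∀ x, c * ‖x‖ ^ 2 ≤ B x x) ∧ (∑ a, B (v a) (v a) = (m : ℝ)) ∧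
      ∀ x, ∑ a, B x (v a) ^ 2 = B x x := by
  set A := V * V.transpose with hA
  have hAu : IsUnit A := isUnit_of_rank_eq (by
    rw [hA, Matrix.rank_self_mul_transpose, hrank, Fintype.card_fin])
  have hAd := (Matrix.isUnit_iff_isUnit_det A).1 hAu
  have hAt : A.transpose = A := by rw [hA, Matrix.transpose_mul, Matrix.transpose_transpose]
  have hAit : (A⁻¹).transpose = A⁻¹ := by rw [Matrix.transpose_nonsing_inv, hAt]
  let B : EuclideanSpace ℝ (Fin m) →L[ℝ] EuclideanSpace ℝ (Fin m) →L[ℝ] ℝ :=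
    LinearMap.toContinuousBilinearMap (LinearMap.mk₂ ℝ
      (fun x y => dotProduct x.ofLp ((A⁻¹).mulVec y.ofLp))
      (fun x x' y => by simp [add_dotProduct]) (fun t x y => by simp)
      (fun x y y' => by simp [Matrix.mulVec_add, dotProduct_add])
      (fun t x y => by simp [Matrix.mulVec_smul]))
  have hBdef : ∀ x y, B x y = dotProduct x.ofLp ((A⁻¹).mulVec y.ofLp) := fun x y => rfl
  have hsymm : ∀ x y, B x y = B y x := fun x y => by
    rw [hBdef, hBdef, Matrix.dotProduct_mulVec, ← Matrix.mulVec_transpose, hAit, dotProduct_comm]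
  have hcol : ∀ a, (v a).ofLp = V.col a := fun a => by
    funext k
    exact (hV a k).symm
  -- This is `x = V Vᵀ A⁻¹ x`; applying `B x` to it yields `hq`.
  have hrec : ∀ x : EuclideanSpace ℝ (Fin m), x = ∑ a, B x (v a) • v a := by
    intro x
    have h1 : ∀ a, B x (v a) = (V.transpose.mulVec ((A⁻¹).mulVec x.ofLp)) a := fun a => by
      rw [hsymm, hBdef, hcol]
      rfl
    ext k
    have h2 : x.ofLp = V.mulVec (V.transpose.mulVec ((A⁻¹).mulVec x.ofLp)) := by
      rw [Matrix.mulVec_mulVec, Matrix.mulVec_mulVec, ← hA, Matrix.mul_nonsing_inv A hAd,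
        Matrix.one_mulVec]
    conv_lhs => rw [h2]
    rw [WithLp.ofLp_sum, Finset.sum_apply]
    simp only [WithLp.ofLp_smul, Pi.smul_apply, smul_eq_mul, h1]
    change ∑ a, V k a * V.transpose.mulVec ((A⁻¹).mulVec x.ofLp) a = _
    refine Finset.sum_congr rfl fun a _ => ?_
    rw [mul_comm, hV]
  have hq : ∀ x, ∑ a, B x (v a) ^ 2 = B x x := fun x => by
    have h := congrArg (B x) (hrec x)
    rw [map_sum] at h
    rw [h]
    exact Finset.sum_congr rfl fun a _ => by rw [map_smul, smul_eq_mul, sq]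
  -- Cauchy–Schwarz in the expansion of `x` gives `‖x‖² ≤ B(x, x) ∑ ‖v_a‖²`; the `1` covers a
  -- vanishing sum.
  have hS : 0 < ∑ a, ‖v a‖ ^ 2 + 1 := by positivity
  refine ⟨B, (∑ a, ‖v a‖ ^ 2 + 1)⁻¹, by positivity, hsymm, fun x => ?_, ?_, hq⟩
  · rw [inv_mul_le_iff₀ hS]
    have h1 : ‖x‖ ≤ ∑ a, |B x (v a)| * ‖v a‖ := by
      conv_lhs => rw [hrec x]
      exact (norm_sum_le _ _).trans (le_of_eq (Finset.sum_congr rfl fun a _ => norm_smul _ _))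
    have h2 := (pow_le_pow_left₀ (norm_nonneg x) h1 2).trans (Finset.sum_mul_sq_le_sq_mul_sq _ _ _)
    simp only [sq_abs, hq] at h2
    have h3 : 0 ≤ B x x := by rw [← hq]; positivity
    linarith
  · have h1 : ∀ a, B (v a) (v a) = (V.transpose * (A⁻¹ * V)) a a := fun a => by
      rw [hBdef, hcol]
      rfl
    have h2 : (V.transpose * (A⁻¹ * V)).trace = m := by
      rw [Matrix.trace_mul_comm, Matrix.mul_assoc, ← hA, Matrix.nonsing_inv_mul A hAd,
        Matrix.trace_one, Fintype.card_fin]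
    rw [Finset.sum_congr rfl fun a _ => h1 a]
    exact h2

/-- Otherwise the interior of the zero set and the nonzero set would be disjoint open sets
separating `Ω`. -/
theorem IsPreconnected.forall_ne_zero {α : Type*} [TopologicalSpace α] {Ω : Set α}
    (hΩ : IsPreconnected Ω) {u : α → ℝ} (hu : Continuous u) (hne : ∃ w ∈ Ω, u w ≠ 0)
    (h : ∀ w ∈ Ω, u w = 0 → ∀ᶠ y in nhds w, u y = 0) : ∀ w ∈ Ω, u w ≠ 0 := by
  intro w hw hw0
  obtain ⟨w', hw', hne'⟩ := hne
  obtain ⟨y, -, hy, hy'⟩ := hΩ {w | ∀ᶠ y in nhds w, u y = 0} {w | u w ≠ 0}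
    isOpen_setOfPred_eventually_nhds (isOpen_ne_fun hu continuous_const)
    (fun z hz => (em (u z = 0)).imp (h z hz) id) ⟨w, hw, h w hw hw0⟩ ⟨w', hw', hne'⟩
  have h0 : ∀ᶠ z in nhds y, u z = 0 := hy
  exact hy' h0.self_of_nhds

/-! ### From weak to classical solutions -/

section
variable {E ι : Type*} [NormedAddCommGroup E] [NormedSpace ℝ E] [Fintype ι]

theorem continuousOn_fderiv_fderiv_apply {u : E → ℝ} {Ω : Set E} (hΩ : IsOpen Ω)
    (hu : ContDiffOn ℝ 2 u Ω) (e e' : E) :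
    ContinuousOn (fun w => fderiv ℝ (fun y => fderiv ℝ u y e) w e') Ω := by
  have h1 : ContDiffOn ℝ 1 (fun y => fderiv ℝ u y e) Ω :=
    (hu.fderiv_of_isOpen hΩ (by norm_num)).clm_apply contDiffOn_const
  exact (h1.continuousOn_fderiv_of_isOpen hΩ (by norm_num)).clm_apply continuousOn_const

theorem continuousOn_sumSecondDeriv {u : E → ℝ} {Ω : Set E} (hΩ : IsOpen Ω)
    (hu : ContDiffOn ℝ 2 u Ω) (v : ι → E) : ContinuousOn (sumSecondDeriv v u) Ω :=
  continuousOn_finsetSum _ fun a _ => continuousOn_fderiv_fderiv_apply hΩ hu (v a) (v a)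

variable [FiniteDimensional ℝ E] [MeasurableSpace E] [BorelSpace E] {μ : Measure E}
  [μ.IsAddHaarMeasure]

theorem integrable_mul_of_tsupport_subset {f φ : E → ℝ} {Ω : Set E} (hΩ : IsOpen Ω)
    (hf : ContinuousOn f Ω) (hφ : Continuous φ) (hc : HasCompactSupport φ) (hs : tsupport φ ⊆ Ω) :
    Integrable (fun w => f w * φ w) μ :=
  Continuous.integrable_of_hasCompactSupport
    (continuous_of_tsupport fun _ hw =>
      (hf.continuousAt (hΩ.mem_nhds (hs (tsupport_mul_subset_right hw)))).mul hφ.continuousAt)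
    hc.mul_left

/-- Two integrations by parts; the support of `φ` confines every derivative of `u` to `Ω`. -/
theorem integral_sumSecondDeriv_mul {u φ : E → ℝ} {Ω : Set E} (hΩ : IsOpen Ω)
    (huc : Continuous u) (hu : ContDiffOn ℝ 2 u Ω) (hφ : ContDiff ℝ 2 φ) (hc : HasCompactSupport φ)
    (hs : tsupport φ ⊆ Ω) (v : ι → E) :
    ∫ w, sumSecondDeriv v u w * φ w ∂μ = ∫ w, u w * sumSecondDeriv v φ w ∂μ := by
  have hφd := hφ.differentiable (by norm_num)
  simp only [sumSecondDeriv, Finset.sum_mul, Finset.mul_sum]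
  rw [integral_finsetSum, integral_finsetSum]
  · refine Finset.sum_congr rfl fun a _ => ?_
    have h1 : ContDiffOn ℝ 1 (fun y => fderiv ℝ u y (v a)) Ω :=
      (hu.fderiv_of_isOpen hΩ (by norm_num)).clm_apply contDiffOn_const
    have hi : Integrable (fun w => fderiv ℝ u w (v a) * fderiv ℝ φ w (v a)) μ :=
      integrable_mul_of_tsupport_subset hΩ h1.continuousOn
        ((hφ.continuous_fderiv (by norm_num)).clm_apply continuous_const) (hc.fderiv_apply ℝ _)
        ((tsupport_fderiv_apply_subset ℝ _).trans hs)
    have h2 := integral_fderiv_mul_fderiv_eq (μ := μ) (g := u) (Ω := Ω)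
      (fun w hw => (hu.contDiffAt (hΩ.mem_nhds hw)).differentiableAt (by norm_num)) huc hφ hc hs hi
    have h3 := integral_mul_fderiv_eq_neg_fderiv_mul_of_integrable (μ := μ)
      (f := fun y => fderiv ℝ u y (v a)) (g := φ) (v := v a)
      (integrable_mul_of_tsupport_subset hΩ (continuousOn_fderiv_fderiv_apply hΩ hu _ _)
        hφ.continuous hc hs) hi
      (integrable_mul_of_tsupport_subset hΩ h1.continuousOn hφ.continuous hc hs)
      (fun w hw => (h1.contDiffAt (hΩ.mem_nhds (hs hw))).differentiableAt (by norm_num))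
      (fun w _ => hφd w)
    linarith
  · exact fun a _ => (huc.mul (continuous_fderiv_fderiv_apply hφ _ _)).integrable_of_hasCompactSupport
      (hasCompactSupport_fderiv_fderiv_apply hc _ _).mul_left
  · exact fun a _ => integrable_mul_of_tsupport_subset hΩ (continuousOn_fderiv_fderiv_apply hΩ hu _ _)
      hφ.continuous hc hs

/-- A `C²` weak solution is a classical solution. -/
theorem sumSecondDeriv_add_eq_zero_of_weak {u : E → ℝ} {Ω : Set E} (hΩ : IsOpen Ω)
    (huc : Continuous u) (hu : ContDiffOn ℝ 2 u Ω) (v : ι → E) (c : ℝ)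
    (hweak : ∀ φ : E → ℝ, ContDiff ℝ 2 φ → HasCompactSupport φ → tsupport φ ⊆ Ω →
      ∫ w, u w * sumSecondDeriv v φ w ∂μ = -(c * ∫ w, u w * φ w ∂μ)) :
    ∀ w ∈ Ω, sumSecondDeriv v u w + c * u w = 0 := by
  have hcont : ContinuousOn (fun w => sumSecondDeriv v u w + c * u w) Ω :=
    (continuousOn_sumSecondDeriv hΩ hu v).add (continuousOn_const.mul huc.continuousOn)
  have hae := hΩ.ae_eq_zero_of_integral_contDiff_smul_eq_zero (μ := μ)
    (hcont.locallyIntegrableOn hΩ.measurableSet) fun φ hφ hc hs => by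
      have hφ2 : ContDiff ℝ 2 φ := by exact_mod_cast contDiff_infty.1 hφ 2
      have h1 := integrable_mul_of_tsupport_subset (μ := μ) hΩ
        (continuousOn_sumSecondDeriv hΩ hu v) hφ.continuous hc hs
      have h2 := integrable_mul_of_tsupport_subset (μ := μ) hΩ huc.continuousOn hφ.continuous hc hs
      have h3 : ∀ w, φ w • (sumSecondDeriv v u w + c * u w) =
        sumSecondDeriv v u w * φ w + c * (u w * φ w) := fun w => by rw [smul_eq_mul]; ring
      simp only [h3]
      rw [integral_add h1 (h2.const_mul c), integral_const_mul,
        integral_sumSecondDeriv_mul hΩ huc hu hφ2 hc hs, hweak φ hφ2 hc hs, neg_add_cancel]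
  have heq := Measure.eqOn_open_of_ae_eq (μ := μ)
    (f := fun w => sumSecondDeriv v u w + c * u w) (g := fun _ => 0)
    ((ae_restrict_iff' hΩ.measurableSet).2 hae) hΩ hcont continuousOn_const
  exact fun w hw => heq hw
end

theorem trace_transpose_mul_hessianMatrix_mul {m n : ℕ} (v : Fin n → EuclideanSpace ℝ (Fin m))
    (V : Matrix (Fin m) (Fin n) ℝ) (hV : ∀ a k, V k a = v a k) {u : EuclideanSpace ℝ (Fin m) → ℝ}
    {w : EuclideanSpace ℝ (Fin m)} (hu : ContDiffAt ℝ 2 u w) :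
    (V.transpose * hessianMatrix u w * V).trace = sumSecondDeriv v u w := by
  have hd : DifferentiableAt ℝ (fderiv ℝ u) w :=
    (hu.fderiv_right (m := 1) (by norm_num)).differentiableAt (by norm_num)
  have hv : ∀ a, v a = ∑ k, V k a • EuclideanSpace.single k (1 : ℝ) := fun a => by
    ext k
    simp [Pi.single_apply, hV]
  refine Finset.sum_congr rfl fun a _ => ?_
  have h1 : fderiv ℝ (fun y => fderiv ℝ u y (v a)) w (v a) = fderiv ℝ (fderiv ℝ u) w (v a) (v a) := by
    have := (hd.hasFDerivAt.clm_apply (hasFDerivAt_const (v a) w)).fderiv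
    rw [this]
    simp
  have h2 : fderiv ℝ (fderiv ℝ u) w (v a) (v a) =
      ∑ l, ∑ k, V k a * (V l a * hessianMatrix u w k l) := by
    rw [hv a]
    simp only [map_sum, map_smul, _root_.sum_apply, _root_.smul_apply, smul_eq_mul,
      Finset.mul_sum, hessianMatrix, Matrix.of_apply, iteratedFDeriv_two_apply]
    exact Finset.sum_congr rfl fun l _ => Finset.sum_congr rfl fun k _ => mul_left_comm _ _ _
  rw [h1, h2, Matrix.diag_apply, Matrix.mul_apply]
  refine Finset.sum_congr rfl fun l _ => ?_
  rw [Matrix.mul_apply, Finset.sum_mul]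
  refine Finset.sum_congr rfl fun k _ => ?_
  rw [Matrix.transpose_apply]
  ring

/-! ### Main theorem -/

theorem theorem1 {m n : ℕ} (C : Matrix (Fin m) (Fin n) ℝ) (hC : C.rank = m)
    (X : Set (EuclideanSpace ℝ (Fin n))) (hX : MeasurableSet X)
    (p : EuclideanSpace ℝ (Fin n) → ℝ) (hp0 : ∀ x ∈ X, 0 ≤ p x)
    (hp : IntegrableOn p X) (hpX : 0 < ∫ x in X, p x)
    (W : Set (EuclideanSpace ℝ (Fin m))) (hW : MeasurableSet W)
    (hWc : IsPreconnected (interior W))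
    (γ : EuclideanSpace ℝ (Fin m) → ℝ)
    (hγ : IsOptimalDensity (linearQuery C) X p W γ)
    (u : EuclideanSpace ℝ (Fin m) → ℝ) (hu : ∀ w, u w = Real.sqrt (γ w)) :
    ∃ I : Matrix (Fin n) (Fin n) ℝ,
      (∀ x, fisherInformation (linearQuery C) W γ x = I) ∧ IsUnit I ∧
      ContDiffOn ℝ 2 u (interior W) ∧
      (∃ μ : ℝ, ∀ w ∈ interior W,
        ((I⁻¹) ^ 2 * C.transpose * hessianMatrix u w * C).trace + μ * u w = 0) ∧
      (∀ w ∈ frontier W, u w = 0) ∧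
      (∀ w ∈ interior W, u w ≠ 0) ∧
      ∫ w in W, u w ^ 2 = 1 := by
  obtain rfl : u = fun w => Real.sqrt (γ w) := funext hu
  obtain ⟨x, hx⟩ := nonempty_of_setIntegral_pos hpX
  have hA := hγ.1.1
  have hreg := (hA.hasRegularFisher_iff x).1 (hγ.1.2 x hx)
  have hpsd := posSemidef_noiseFisher hA.nonneg hreg.1
  have huc : Continuous fun w => Real.sqrt (γ w) := hA.continuous.sqrt
  set N := noiseFisher C γ with hN
  have hNdet := (Matrix.isUnit_iff_isUnit_det N).1 hreg.2
  have hV : ∀ a k, (C * N⁻¹) k a = optimalDirection C γ a k := fun a k => rfl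
  have hrank : (C * N⁻¹).rank = m := by
    rw [Matrix.rank_mul_eq_left_of_isUnit_det _ _ (Matrix.isUnit_nonsing_inv_det _ hNdet), hC]
  obtain ⟨B, c, hc, hB, hcB, htr, hq⟩ := exists_dual_form _ _ hV hrank
  have hweak := fun (φ : EuclideanSpace ℝ (Fin m) → ℝ) (h1 : ContDiff ℝ 2 φ)
    (h2 : HasCompactSupport φ) (h3 : tsupport φ ⊆ interior W) =>
    integral_sqrt_mul_sumSecondDeriv hpX hγ h1 h2 h3
  have hpos : ∀ w ∈ interior W, Real.sqrt (γ w) ≠ 0 := by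
    refine hWc.forall_ne_zero huc ?_ fun w hw hw0 => ?_
    · by_contra! h
      have h0 : ∀ w, γ w = 0 := fun w => by
        by_contra hne
        exact hne ((Real.sqrt_eq_zero (hA.nonneg w)).1 (h w (hA.mem_interior hne)))
      have := hA.integral_univ
      simp [h0] at this
    · refine eventually_eq_zero_of_weak_supersolution (μ := volume) hB hc hcB
        (optimalDirection C γ) (by rw [htr, finrank_euclideanSpace_fin]) hq huc
        (fun _ => Real.sqrt_nonneg _) isOpen_interior hw hw0 fun φ h1 h2 h3 h4 => ?_
      -- The weak equation makes `u` a supersolution, because `Tr(I⁻¹) ≥ 0` and `u, φ ≥ 0`.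
      rw [hweak φ h1 h2 h3]
      exact neg_nonpos.2 (mul_nonneg (div_nonneg hpsd.inv.trace_nonneg (by norm_num))
        (integral_nonneg fun w => mul_nonneg (Real.sqrt_nonneg _) (h4 w)))
  -- Regularity comes only after positivity: the square root is smooth away from `0`.
  have hcd : ContDiffOn ℝ 2 (fun w => Real.sqrt (γ w)) (interior W) :=
    (hA.contDiffOn.mono interior_subset).sqrt fun w hw h => hpos w hw (by rw [h, Real.sqrt_zero])
  refine ⟨N, hA.fisherInformation_eq, hreg.2, hcd, ⟨(N⁻¹).trace / 4, fun w hw => ?_⟩,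
    fun w hw => by simp only [hA.boundary w hw, Real.sqrt_zero], hpos, ?_⟩
  · have h := sumSecondDeriv_add_eq_zero_of_weak (μ := volume) isOpen_interior huc hcd
      (optimalDirection C γ) _ hweak w hw
    have hNt : (N⁻¹).transpose = N⁻¹ := hpsd.1.inv
    -- Symmetry of `I⁻¹` and cyclicity of the trace turn `Tr((C I⁻¹)ᵀ D²u C I⁻¹)` into `Tr(I⁻² Cᵀ
    -- D²u C)`.
    rw [← trace_transpose_mul_hessianMatrix_mul _ _ hV
      (hcd.contDiffAt (isOpen_interior.mem_nhds hw)), Matrix.transpose_mul, hNt,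
      ← Matrix.mul_assoc, Matrix.trace_mul_comm] at h
    simpa only [sq, Matrix.mul_assoc] using h
  · simp only [Real.sq_sqrt (hA.nonneg _)]
    exact hA.integral_eq_one
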